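/- Let $M$ be a smooth (finite-dimensional, Hausdorff) manifold with a smooth almost complex structure $J$ (a smooth field of endomorphisms of $TM$ with $J^2=-\mathrm{Id}$) and a smooth linear connection $D$ on $TM$ (not assumed torsion-free). Let $R^{D}_{X,Y} := -D_XD_Y + D_YD_X + D_{[X,Y]}$ be the curvature of $D$, let $D_X(J)(Y) := D_X(JY) - J(D_XY)$, and let $J^*\xi := \xi\circ J$ for $\xi\in T^*M$. The connection induced by $D$ on the cotangent bundle $\pi : T^*M\to M$ splits $T(T^*M)$ into its horizontal and vertical subbundles, and so gives an identification $T_\gamma(T^*M) = T_{\pi(\gamma)}M\oplus T^*_{\pi(\gamma)}M$ for all $\gamma\in T^*M$. For each choice of sign $\pm$, let $J^{\pm}$ be the almost complex structure on the manifold $T^*M$ which, under this identification, is given at $\gamma$ by the value at $\pi(\gamma)$ of $$ \mathcal J^{\pm} := \begin{pmatrix} J & 0\\ 0 & \pm J^*\end{pmatrix} . $$ An almost complex structure is called integrable if its Nijenhuis tensor vanishes, equivalently if its bundle of vectors of type $(1,0)$ is involutive. Then $J^{\pm}$ is integrable if and only if the following three conditions hold (with the same sign throughout): $J$ is integrable;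 $$ D_X(J) = \pm\, J\, D_{JX}(J) \quad\text{for all } X\in TM; $$ and $$ \left(R^{D}_{X,Y} - R^{D}_{JX,JY}\right)(Z) \pm \left(R^{D}_{JX,Y} + R^{D}_{X,JY}\right)(JZ) = 0 \quad\text{for all } X,Y,Z\in TM . $$ -/

import Mathlib

open Bundle FiberBundle VectorField
open scoped Manifold ContDiff Topology

noncomputable section

namespace CotangentLift

variable {E : Type*} [NormedAddCommGroup E] [NormedSpace ℝ E]
  {M : Type*} [TopologicalSpace M] [ChartedSpace E M]

/-! ### Almost complex structures on a manifold and their integrability -/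

section AlmostComplex

variable {E' : Type*} [NormedAddCommGroup E'] [NormedSpace ℝ E'] {H' : Type*}
  [TopologicalSpace H'] (I : ModelWithCorners ℝ E' H') {N : Type*} [TopologicalSpace N]
  [ChartedSpace H' N] [IsManifold I ∞ N]

/-- The (not necessarily continuous) vector field `X` on `N` is `C^∞` on the set `U`. -/
def SmoothVectorFieldOn (X : Π x : N, TangentSpace I x) (U : Set N) : Prop :=
  ContMDiffOn I (I.prod 𝓘(ℝ, E')) ∞ (fun x ↦ (⟨x, X x⟩ : TangentBundle I N)) U

/-- `J` is an almost complex structure on `N`: a smooth field of endomorphisms of the tangent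
spaces with `J² = -Id`. -/
structure IsAlmostComplex (J : Π x : N, TangentSpace I x →L[ℝ] TangentSpace I x) : Prop where
  smooth : ContMDiff I (I.prod 𝓘(ℝ, E' →L[ℝ] E')) ∞
    (fun x ↦ TotalSpace.mk' (E' →L[ℝ] E')
      (E := fun x : N ↦ TangentSpace I x →L[ℝ] TangentSpace I x) x (J x))
  sq : ∀ (x : N) (v : TangentSpace I x), J x (J x v) = -v

/-- The Nijenhuis expression `[JX, JY] - J[JX, Y] - J[X, JY] - [X, Y]` at the point `x`. -/
def nijenhuis (J : Π x : N, TangentSpace I x →L[ℝ] TangentSpace I x)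
    (X Y : Π x : N, TangentSpace I x) (x : N) : TangentSpace I x :=
  mlieBracket I (fun y ↦ J y (X y)) (fun y ↦ J y (Y y)) x
    - J x (mlieBracket I (fun y ↦ J y (X y)) Y x)
    - J x (mlieBracket I X (fun y ↦ J y (Y y)) x)
    - mlieBracket I X Y x

/-- Integrability of a field `J` of endomorphisms with `J² = -Id`: the Nijenhuis expression
vanishes on all (locally defined) smooth vector fields `X`, `Y`. As
`[X - iJX, Y - iJY] = ([X, Y] - [JX, JY]) - i([JX, Y] + [X, JY])`, this says precisely that the
bundle of vectors of type `(1,0)` (the `i`-eigenbundle of `J`) is involutive. -/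
def IsIntegrable (J : Π x : N, TangentSpace I x →L[ℝ] TangentSpace I x) : Prop :=
  ∀ (U : Set N), IsOpen U → ∀ (X Y : Π x : N, TangentSpace I x),
    SmoothVectorFieldOn I X U → SmoothVectorFieldOn I Y U → ∀ x ∈ U, nijenhuis I J X Y x = 0

end AlmostComplex

/-! ### The cotangent bundle, linear connections and their tensors -/

variable (E) in
/-- The cotangent space `T_x^*M`. -/
abbrev CotangentSpace (x : M) : Type _ := TangentSpace 𝓘(ℝ, E) x →L[ℝ] ℝ

variable [IsManifold 𝓘(ℝ, E) ∞ M]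

variable (E M) in
/-- The cotangent manifold `T^*M`: the total space of the bundle of continuous linear maps from
`TM` to the trivial line bundle. -/
abbrev CotangentBundle : Type _ :=
  TotalSpace (E →L[ℝ] ℝ) (CotangentSpace E : M → Type _)

variable (E M) in
/-- Linear connections on (the tangent bundle of) `M`. In Mathlib `D Y x v` is `(D_v Y)(x)`. -/
abbrev Connection : Type _ :=
  CovariantDerivative 𝓘(ℝ, E) E (TangentSpace 𝓘(ℝ, E) : M → Type _)

variable (E) in
/-- The model with corners of the manifold `T^*M`. -/
abbrev cotangentModel : ModelWithCorners ℝ (E × (E →L[ℝ] ℝ)) (ModelProd E (E →L[ℝ] ℝ)) :=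
  𝓘(ℝ, E).prod 𝓘(ℝ, E →L[ℝ] ℝ)

/-- The `1`-form `α` on `M` is differentiable at `x`. -/
abbrev OneFormMDiffAt (α : Π x : M, CotangentSpace E x) (x : M) : Prop :=
  MDifferentiableAt 𝓘(ℝ, E) (cotangentModel E)
    (fun y ↦ (⟨y, α y⟩ : CotangentBundle E M)) x

theorem mdifferentiableAt_pairing {α : Π x : M, CotangentSpace E x}
    {Y : Π x : M, TangentSpace 𝓘(ℝ, E) x} {x : M}
    (hα : OneFormMDiffAt α x)
    (hY : MDiffAt (T% Y) x) : MDiffAt (fun y ↦ α y (Y y)) x := by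
  have : MDifferentiableAt 𝓘(ℝ, E) (𝓘(ℝ, E).prod 𝓘(ℝ))
      (fun m ↦ TotalSpace.mk' ℝ (E := Bundle.Trivial M ℝ) m (α m (Y m))) x :=
    MDifferentiableAt.clm_bundle_apply hα hY
  rw [mdifferentiableAt_totalSpace] at this
  exact this.2

/-- `(D_X J)(Y) = D_X (J Y) - J (D_X Y)`. -/
def covDerivEnd (D : Connection E M) (J : Π x : M, TangentSpace 𝓘(ℝ, E) x →L[ℝ]
    TangentSpace 𝓘(ℝ, E) x) (X Y : Π x : M, TangentSpace 𝓘(ℝ, E) x) (x : M) :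
    TangentSpace 𝓘(ℝ, E) x :=
  D (fun y ↦ J y (Y y)) x (X x) - J x (D Y x (X x))

/-- The curvature, with the sign convention
`R_{X,Y} Z = - D_X D_Y Z + D_Y D_X Z + D_{[X,Y]} Z`. -/
def curvature (D : Connection E M) (X Y Z : Π x : M, TangentSpace 𝓘(ℝ, E) x) (x : M) :
    TangentSpace 𝓘(ℝ, E) x :=
  - D (fun y ↦ D Z y (Y y)) x (X x) + D (fun y ↦ D Z y (X y)) x (Y x)
    + D Z x (mlieBracket 𝓘(ℝ, E) X Y x)

/-! ### The dual connection on the cotangent bundle -/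

variable [FiniteDimensional ℝ E]
instance finiteDimensional_tangentSpace (x : M) : FiniteDimensional ℝ (TangentSpace 𝓘(ℝ, E) x) :=
  inferInstanceAs (FiniteDimensional ℝ E)

instance t2Space_tangentSpace (x : M) : T2Space (TangentSpace 𝓘(ℝ, E) x) :=
  inferInstanceAs (T2Space E)

instance finiteDimensional_tangentSpace_cotangent (γ : CotangentBundle E M) : FiniteDimensional ℝ (TangentSpace (cotangentModel E) γ) :=
  inferInstanceAs (FiniteDimensional ℝ (E × (E →L[ℝ] ℝ)))

instance t2Space_tangentSpace_cotangent (γ : CotangentBundle E M) : T2Space (TangentSpace (cotangentModel E) γ) :=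
  inferInstanceAs (T2Space (E × (E →L[ℝ] ℝ)))

instance finiteDimensional_cotangentSpace (x : M) : FiniteDimensional ℝ (CotangentSpace E x) :=
  inferInstanceAs (FiniteDimensional ℝ (E →L[ℝ] ℝ))

/-- `v (α(Y)) - α(D_v Y)` at the point `x`. -/
def dualAux (D : Connection E M) (α : Π x : M, CotangentSpace E x) (x : M)
   (v : TangentSpace 𝓘(ℝ, E) x) (Y : Π x : M, TangentSpace 𝓘(ℝ, E) x) : ℝ :=
  d% (fun y ↦ α y (Y y)) x v - α x (D Y x v)

theorem dualAux_tensorial (D : Connection E M) {α : Π x : M, CotangentSpace E x} {x : M}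
    (hα : OneFormMDiffAt α x)
    (v : TangentSpace 𝓘(ℝ, E) x) : TensorialAt 𝓘(ℝ, E) E (dualAux D α x v) x where
  smul {f Y} hf hY := by
    have h := mdifferentiableAt_pairing hα hY
    have : (fun y ↦ α y ((f • Y) y)) = fun y ↦ f y * α y (Y y) := by
      ext y; simp
    rw [dualAux, this, mvfderiv_fun_mul hf h, D.isCovariantDerivativeOnUniv.leibniz hY hf]
    simp [dualAux]
    ring
  add {Y Y'} hY hY' := by
    have h := mdifferentiableAt_pairing hα hY
    have h' := mdifferentiableAt_pairing hα hY'
    have : (fun y ↦ α y ((Y + Y') y)) = fun y ↦ α y (Y y) + α y (Y' y) := by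
      ext y; simp
    rw [dualAux, this, mvfderiv_fun_add h h', D.isCovariantDerivativeOnUniv.add hY hY']
    simp [dualAux]
    ring

open Classical in
/-- The covariant derivative `D_v α` of a `1`-form `α` (set to `0` where `α` is not
differentiable); it is characterized by the Leibniz rule `dualFun_apply`. -/
def dualFun (D : Connection E M) (α : Π x : M, CotangentSpace E x) (x : M) :
    TangentSpace 𝓘(ℝ, E) x →L[ℝ] CotangentSpace E x :=
  if hα : OneFormMDiffAt α x then
    LinearMap.toContinuousLinearMap
      { toFun := fun v ↦ TensorialAt.mkHom (dualAux D α x v) x (dualAux_tensorial D hα v)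
        map_add' := fun v w ↦ by
          ext u
          simp [TensorialAt.mkHom_apply_eq_extend, dualAux]
          ring
        map_smul' := fun c v ↦ by
          ext u
          simp [TensorialAt.mkHom_apply_eq_extend, dualAux]
          ring }
  else 0

/-- Leibniz rule: `(D_v α)(Y) = v(α(Y)) - α(D_v Y)`. -/
theorem dualFun_apply (D : Connection E M) {α : Π x : M, CotangentSpace E x} {x : M}
    (hα : OneFormMDiffAt α x) (v : TangentSpace 𝓘(ℝ, E) x)
    {Y : Π x : M, TangentSpace 𝓘(ℝ, E) x} (hY : MDiffAt (T% Y) x) :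
    dualFun D α x v (Y x) = d% (fun y ↦ α y (Y y)) x v - α x (D Y x v) := by
  simp only [dualFun, dif_pos hα]
  exact TensorialAt.mkHom_apply (dualAux_tensorial D hα v) hY

/-- The action of `D` on the cotangent bundle: the connection on `T^*M` induced by `D`. -/
def dual (D : Connection E M) :
    CovariantDerivative 𝓘(ℝ, E) (E →L[ℝ] ℝ) (CotangentSpace E : M → Type _) where
  toFun := dualFun D
  isCovariantDerivativeOnUniv :=
    { add := fun {α β x} hα hβ _ ↦ by
        have hαβ : OneFormMDiffAt (α + β) x := mdifferentiableAt_add_section hα hβ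
        ext v w
        have hw := mdifferentiableAt_extend 𝓘(ℝ, E) E w
        rw [← extend_apply_self E w]
        simp only [add_apply]
        rw [dualFun_apply D hαβ v hw, dualFun_apply D hα v hw, dualFun_apply D hβ v hw]
        have := mvfderiv_fun_add (mdifferentiableAt_pairing hα hw) (mdifferentiableAt_pairing hβ hw)
        simp only [Pi.add_apply, add_apply, this]
        ring
      leibniz := fun {α f x} hα hf _ ↦ by
        have hfα : OneFormMDiffAt (f • α) x := hf.smul_section hα
        ext v w
        have hw := mdifferentiableAt_extend 𝓘(ℝ, E) E w
        rw [← extend_apply_self E w]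
        simp only [add_apply, smul_apply]
        rw [dualFun_apply D hfα v hw, dualFun_apply D hα v hw]
        have := mvfderiv_fun_mul hf (mdifferentiableAt_pairing hα hw)
        simp only [Pi.smul_apply', smul_apply, smul_eq_mul, this]
        simp
        ring }

/-! ### The splitting of the tangent bundle of the cotangent manifold -/

/-- The vertical lift `T_p^*M → T_γ(T^*M)`, `p = π(γ)`: the velocity at `t = 0` of the curve
`t ↦ γ + t ξ` in the fibre. -/
def vertLift (γ : CotangentBundle E M) (ξ : CotangentSpace E γ.proj) :
    TangentSpace (cotangentModel E) γ :=
  mfderiv 𝓘(ℝ, ℝ) (cotangentModel E)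
    (fun t : ℝ ↦ (⟨γ.proj, γ.snd + t • ξ⟩ : CotangentBundle E M)) 0 (1 : ℝ)

/-- The `D`-horizontal lift at `γ ∈ T_p^*M` of `v ∈ T_pM`: it is `dα(v) - vert(D_v α)` for any
`1`-form `α` with `α(p) = γ`, in particular `dα(v)` if `D_v α = 0`. Here it is computed with one
such `α`; see `mfderiv_oneForm` for the independence. -/
def horLift (D : Connection E M) (γ : CotangentBundle E M) (v : TangentSpace 𝓘(ℝ, E) γ.proj) :
    TangentSpace (cotangentModel E) γ :=
  letI dα : TangentSpace (cotangentModel E) γ :=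
    mfderiv 𝓘(ℝ, E) (cotangentModel E)
      (fun y ↦ (⟨y, extend (E →L[ℝ] ℝ) γ.snd y⟩ : CotangentBundle E M)) γ.proj v
  dα - vertLift γ (dual D (extend (E →L[ℝ] ℝ) γ.snd) γ.proj v)


theorem hasMFDerivAt_cotangentBundle {E' : Type*} [NormedAddCommGroup E'] [NormedSpace ℝ E']
    {H' : Type*} [TopologicalSpace H'] {I : ModelWithCorners ℝ E' H'} {N : Type*}
    [TopologicalSpace N] [ChartedSpace H' N] {f : N → CotangentBundle E M} {x : N}
    (hf : MDifferentiableAt I (cotangentModel E) f x) {A : E' →L[ℝ] E} {B : E' →L[ℝ] E →L[ℝ] ℝ}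
    (h1 : HasMFDerivAt I 𝓘(ℝ, E) (fun y ↦ (f y).proj) x A)
    (h2 : HasMFDerivAt I 𝓘(ℝ, E →L[ℝ] ℝ)
      (fun y ↦ (trivializationAt (E →L[ℝ] ℝ) (CotangentSpace E) (f x).proj (f y)).2) x B) :
    HasMFDerivAt I (cotangentModel E) f x (A.prod B : E' →L[ℝ] (E × (E →L[ℝ] ℝ))) := by
  refine ⟨hf.continuousAt, ?_⟩
  set e := trivializationAt (E →L[ℝ] ℝ) (CotangentSpace E) (f x).proj with he
  have hb : (f x).proj ∈ e.baseSet := mem_baseSet_trivializationAt' _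
  have hext : ∀ q : CotangentBundle E M, q.proj ∈ e.baseSet →
      extChartAt (cotangentModel E) (f x) q =
        (extChartAt 𝓘(ℝ, E) (f x).proj q.proj, (e q).2) := by
    intro q hq
    rw [FiberBundle.extChartAt]
    change (extChartAt 𝓘(ℝ, E) (f x).proj (e q).1, (e q).2) = _
    rw [e.coe_fst' hq]
  have hc : ∀ᶠ y in 𝓝 x, (f y).proj ∈ e.baseSet :=
    h1.1.eventually (e.open_baseSet.mem_nhds hb)
  have hc' : ∀ᶠ z in 𝓝[Set.range I] (extChartAt I x x),
      (f ((extChartAt I x).symm z)).proj ∈ e.baseSet := by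
    have := (continuousAt_extChartAt_symm (I := I) x).tendsto.mono_left
      (nhdsWithin_le_nhds (s := Set.range I))
    rw [extChartAt_to_inv] at this
    exact this.eventually hc
  refine (HasFDerivWithinAt.prodMk h1.2 h2.2).congr_of_eventuallyEq ?_ ?_
  · filter_upwards [hc'] with z hz
    exact hext _ hz
  · have := hext (f x) hb
    simp only [writtenInExtChartAt, Function.comp_apply, extChartAt_to_inv]
    exact this

theorem vertLift_coord (γ : CotangentBundle E M) (ξ : CotangentSpace E γ.proj) :
    (vertLift γ ξ : E × (E →L[ℝ] ℝ)) =
      (0, (trivializationAt (E →L[ℝ] ℝ) (CotangentSpace E) γ.proj).continuousLinearMapAt ℝ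
        γ.proj ξ) := by
  set e := trivializationAt (E →L[ℝ] ℝ) (CotangentSpace E) γ.proj with he
  have hb : γ.proj ∈ e.baseSet := mem_baseSet_trivializationAt' _
  set L := e.continuousLinearMapAt ℝ γ.proj with hL
  have hfun : (fun t : ℝ ↦ (e (⟨γ.proj, γ.snd + t • ξ⟩ : CotangentBundle E M)).2) =
      fun t : ℝ ↦ L γ.snd + t • L ξ := by
    ext1 t
    rw [← map_smul, ← map_add, hL, e.continuousLinearMapAt_apply ℝ, e.coe_linearMapAt_of_mem hb]
  have hd : HasFDerivAt (fun t : ℝ ↦ L γ.snd + t • L ξ)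
      ((ContinuousLinearMap.id ℝ ℝ).smulRight (L ξ)) 0 :=
    ((hasFDerivAt_id (0 : ℝ)).smul_const (L ξ)).const_add _
  have hd' : HasMFDerivAt 𝓘(ℝ, ℝ) 𝓘(ℝ, E →L[ℝ] ℝ)
      (fun t : ℝ ↦ (e (⟨γ.proj, γ.snd + t • ξ⟩ : CotangentBundle E M)).2) 0
      ((ContinuousLinearMap.id ℝ ℝ).smulRight (L ξ)) := by
    rw [hfun]
    exact hd.hasMFDerivAt
  have h1 : HasMFDerivAt 𝓘(ℝ, ℝ) 𝓘(ℝ, E)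
      (fun t : ℝ ↦ (⟨γ.proj, γ.snd + t • ξ⟩ : CotangentBundle E M).proj) 0 (0 : ℝ →L[ℝ] E) :=
    hasMFDerivAt_const _ _
  have hm : MDifferentiableAt 𝓘(ℝ, ℝ) (cotangentModel E)
      (fun t : ℝ ↦ (⟨γ.proj, γ.snd + t • ξ⟩ : CotangentBundle E M)) 0 := by
    rw [mdifferentiableAt_totalSpace]
    exact ⟨mdifferentiableAt_const, hd'.mdifferentiableAt⟩
  have key := (hasMFDerivAt_cotangentBundle hm h1 hd').mfderiv
  have := DFunLike.congr_fun key (1 : ℝ)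
  refine this.trans ?_
  change ((0 : E), (1 : ℝ) • L ξ) = _
  rw [one_smul]

theorem oneForm_coord {α : Π x : M, CotangentSpace E x} {x : M} (hα : OneFormMDiffAt α x) :
    ∃ B : E →L[ℝ] E →L[ℝ] ℝ,
      (∀ v : E, (mfderiv 𝓘(ℝ, E) (cotangentModel E)
        (fun y ↦ (⟨y, α y⟩ : CotangentBundle E M)) x v : E × (E →L[ℝ] ℝ)) = (v, B v)) ∧
      ∀ (D : Connection E M) (v w : TangentSpace 𝓘(ℝ, E) x),
        B v ((trivializationAt E (TangentSpace 𝓘(ℝ, E) : M → Type _) x).continuousLinearMapAt ℝ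
          x w) = dual D α x v w + α x (D (extend E w) x v) := by
  have h2 := ((mdifferentiableAt_totalSpace _ _).1 hα).2.hasMFDerivAt
  have h1 : HasMFDerivAt 𝓘(ℝ, E) 𝓘(ℝ, E)
    (fun y ↦ (⟨y, α y⟩ : CotangentBundle E M).proj) x (ContinuousLinearMap.id ℝ E) :=
    hasMFDerivAt_id x
  refine ⟨_, fun v ↦ DFunLike.congr_fun (hasMFDerivAt_cotangentBundle hα h1 h2).mfderiv v, ?_⟩
  intro D v w
  set eT := trivializationAt E (TangentSpace 𝓘(ℝ, E) : M → Type _) x with heT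
  set u : E := eT.continuousLinearMapAt ℝ x w with hu
  have hx : x ∈ eT.baseSet := mem_baseSet_trivializationAt' _
  have hY : MDiffAt (T% (extend E w)) x := mdifferentiableAt_extend 𝓘(ℝ, E) E w
  have hu' : u = (eT ⟨x, w⟩).2 := by
    rw [hu, eT.continuousLinearMapAt_apply ℝ, eT.coe_linearMapAt_of_mem hx]
  have hfun : (fun y ↦ α y (extend E w y)) =ᶠ[𝓝 x]
      (ContinuousLinearMap.apply ℝ ℝ u) ∘ (fun y ↦ (trivializationAt (E →L[ℝ] ℝ)
        (CotangentSpace E) x (⟨y, α y⟩ : CotangentBundle E M)).2) := by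
    filter_upwards [eT.open_baseSet.mem_nhds hx] with y hy
    have := hom_trivializationAt_apply (RingHom.id ℝ) (F₁ := E)
      (E₁ := (TangentSpace 𝓘(ℝ, E) : M → Type _)) (F₂ := ℝ) (E₂ := Bundle.Trivial M ℝ) x ⟨y, α y⟩
    have h' := congrArg Prod.snd this
    refine Eq.symm ((DFunLike.congr_fun h' u).trans ?_)
    simp only [ContinuousLinearMap.inCoordinates, ContinuousLinearMap.comp_apply]
    rw [hu']
    simp [extend, ← heT, eT.symmL_apply hy]
  have hB := (ContinuousLinearMap.apply ℝ ℝ u).hasMFDerivAt.comp x h2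
  have hB' := hB.congr_of_eventuallyEq hfun
  have h3 := dualFun_apply D hα v hY
  rw [extend_apply_self] at h3
  have h4 := DFunLike.congr_fun hB'.mfderiv v
  change _ = dualFun D α x v w + _
  rw [h3, sub_add_cancel]
  exact h4.symm

theorem fiberCoord_apply (x : M) (ξ : CotangentSpace E x) (w : TangentSpace 𝓘(ℝ, E) x) :
    ((trivializationAt (E →L[ℝ] ℝ) (CotangentSpace E) x).continuousLinearMapAt ℝ x ξ : E →L[ℝ] ℝ)
      ((trivializationAt E (TangentSpace 𝓘(ℝ, E) : M → Type _) x).continuousLinearMapAt ℝ x w) =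
      ξ w := by
  set eT := trivializationAt E (TangentSpace 𝓘(ℝ, E) : M → Type _) x with heT
  set e := trivializationAt (E →L[ℝ] ℝ) (CotangentSpace E) x with he
  have hx : x ∈ eT.baseSet := mem_baseSet_trivializationAt' _
  have hx' : x ∈ e.baseSet := mem_baseSet_trivializationAt' _
  rw [e.continuousLinearMapAt_apply ℝ, e.coe_linearMapAt_of_mem hx']
  have := hom_trivializationAt_apply (RingHom.id ℝ) (F₁ := E)
      (E₁ := (TangentSpace 𝓘(ℝ, E) : M → Type _)) (F₂ := ℝ) (E₂ := Bundle.Trivial M ℝ) x ⟨x, ξ⟩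
  have h' := congrArg Prod.snd this
  refine (DFunLike.congr_fun h' _).trans ?_
  simp only [ContinuousLinearMap.inCoordinates, ContinuousLinearMap.comp_apply]
  rw [Trivialization.symmL_continuousLinearMapAt _ hx]
  simp

theorem horLift_coord (D : Connection E M) {α : Π x : M, CotangentSpace E x} {x : M}
    {A : E →L[ℝ] E →L[ℝ] ℝ}
    (hA : ∀ (v w : TangentSpace 𝓘(ℝ, E) x),
      A v ((trivializationAt E (TangentSpace 𝓘(ℝ, E) : M → Type _) x).continuousLinearMapAt ℝ
          x w) = dual D α x v w + α x (D (extend E w) x v)) (v : E) :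
    (horLift D ⟨x, α x⟩ v : E × (E →L[ℝ] ℝ)) =
      (v, A v - (trivializationAt (E →L[ℝ] ℝ) (CotangentSpace E) x).continuousLinearMapAt ℝ
        x (dual D α x v)) := by
  have hε : OneFormMDiffAt (extend (E →L[ℝ] ℝ) (α x)) x :=
    mdifferentiableAt_extend 𝓘(ℝ, E) (E →L[ℝ] ℝ) (α x)
  obtain ⟨B, hB, hB'⟩ := oneForm_coord hε
  set eT := trivializationAt E (TangentSpace 𝓘(ℝ, E) : M → Type _) x with heT
  have hx : x ∈ eT.baseSet := mem_baseSet_trivializationAt' _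
  have h1 : (horLift D ⟨x, α x⟩ v : E × (E →L[ℝ] ℝ)) = (v, B v) - ((0 : E),
      (trivializationAt (E →L[ℝ] ℝ) (CotangentSpace E) x).continuousLinearMapAt ℝ
        x (dual D (extend (E →L[ℝ] ℝ) (α x)) x v)) := by
    rw [← hB, ← vertLift_coord ⟨x, α x⟩]
    rfl
  rw [h1]
  refine Prod.ext (sub_zero _) ?_
  change B v - _ = A v - _
  refine ContinuousLinearMap.ext fun u ↦ ?_
  obtain ⟨w, rfl⟩ : ∃ w : TangentSpace 𝓘(ℝ, E) x, eT.continuousLinearMapAt ℝ x w = u :=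
    ⟨eT.symmL ℝ x u, eT.continuousLinearMapAt_symmL hx u⟩
  refine (congrArg₂ (· - ·) (hB' D v w) (fiberCoord_apply x _ w)).trans ?_
  refine Eq.trans ?_ (congrArg₂ (· - ·) (hA v w) (fiberCoord_apply x _ w)).symm
  simp

/-- For every `1`-form `α`, the horizontal and vertical components of `dα(v)` are `v` and
`D_v α`. -/
theorem mfderiv_oneForm (D : Connection E M) {α : Π x : M, CotangentSpace E x} {x : M}
    (hα : OneFormMDiffAt α x) (v : TangentSpace 𝓘(ℝ, E) x) :
    mfderiv 𝓘(ℝ, E) (cotangentModel E) (fun y ↦ (⟨y, α y⟩ : CotangentBundle E M)) x v =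
      horLift D ⟨x, α x⟩ v + vertLift ⟨x, α x⟩ (dual D α x v) := by
  obtain ⟨A, hA, hA'⟩ := oneForm_coord hα
  refine (hA v).trans ?_
  have h1 := horLift_coord D (hA' D) v
  have h2 := vertLift_coord ⟨x, α x⟩ (dual D α x v)
  refine Eq.trans ?_ (congrArg₂ (· + ·) h1 h2).symm
  refine Prod.ext ?_ ?_
  · exact (add_zero _).symm
  · exact (sub_add_cancel _ _).symm

theorem exists_splitting_coord (D : Connection E M) (γ : CotangentBundle E M) :
    ∃ (C : E →L[ℝ] E →L[ℝ] ℝ) (L : CotangentSpace E γ.proj →L[ℝ] E →L[ℝ] ℝ),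
      Function.Injective L ∧ ∀ (v : E) (ξ : CotangentSpace E γ.proj),
        (horLift D γ v + vertLift γ ξ : E × (E →L[ℝ] ℝ)) = (v, C v + L ξ) := by
  set e := trivializationAt (E →L[ℝ] ℝ) (CotangentSpace E) γ.proj with he
  have hx : γ.proj ∈ e.baseSet := mem_baseSet_trivializationAt' _
  have hε : OneFormMDiffAt (extend (E →L[ℝ] ℝ) γ.snd) γ.proj :=
    mdifferentiableAt_extend 𝓘(ℝ, E) (E →L[ℝ] ℝ) γ.snd
  obtain ⟨B, hB, -⟩ := oneForm_coord hε
  let K : E →L[ℝ] E →L[ℝ] ℝ :=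
    (e.continuousLinearMapAt ℝ γ.proj).comp (dual D (extend (E →L[ℝ] ℝ) γ.snd) γ.proj)
  refine ⟨B - K,
    e.continuousLinearMapAt ℝ γ.proj, ?_, fun v ξ ↦ ?_⟩
  · exact Function.LeftInverse.injective (g := e.symmL ℝ γ.proj)
      fun ξ ↦ e.symmL_continuousLinearMapAt hx ξ
  · have h2 := vertLift_coord γ
    have h1 : (horLift D γ v : E × (E →L[ℝ] ℝ)) = (v, B v) - ((0 : E),
      e.continuousLinearMapAt ℝ γ.proj (dual D (extend (E →L[ℝ] ℝ) γ.snd) γ.proj v)) := by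
      rw [← hB, ← h2]
      rfl
    refine (congrArg₂ (· + ·) h1 (h2 ξ)).trans ?_
    refine Prod.ext ?_ rfl
    change v - 0 + 0 = v
    rw [sub_zero, add_zero]

/-- `T_pM ⊕ T_p^*M → T_γ(T^*M)`, `(v, ξ) ↦ (horizontal lift of v) + (vertical lift of ξ)`. -/
def splittingMap (D : Connection E M) (γ : CotangentBundle E M) :
    (TangentSpace 𝓘(ℝ, E) γ.proj × CotangentSpace E γ.proj) →ₗ[ℝ]
      TangentSpace (cotangentModel E) γ where
  toFun p := horLift D γ p.1 + vertLift γ p.2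
  map_add' p q := by
    obtain ⟨C, L, -, h⟩ := exists_splitting_coord D γ
    refine (h (p.1 + q.1) (p.2 + q.2)).trans
      (Eq.trans ?_ (congrArg₂ (· + ·) (h p.1 p.2) (h q.1 q.2)).symm)
    refine Prod.ext rfl ?_
    change C (p.1 + q.1) + L (p.2 + q.2) = C p.1 + L p.2 + (C q.1 + L q.2)
    rw [map_add L]
    refine (congrArg (· + _) (C.map_add p.1 q.1)).trans ?_
    abel
  map_smul' c p := by
    obtain ⟨C, L, -, h⟩ := exists_splitting_coord D γ
    refine (h (c • p.1) (c • p.2)).trans (Eq.trans ?_ (congrArg (c • ·) (h p.1 p.2)).symm)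
    refine Prod.ext rfl ?_
    change C (c • p.1) + L (c • p.2) = c • (C p.1 + L p.2)
    rw [map_smul L, smul_add]
    exact congrArg (· + _) (C.map_smul c p.1)

theorem splittingMap_injective (D : Connection E M) (γ : CotangentBundle E M) :
    Function.Injective (splittingMap D γ) := by
  obtain ⟨C, L, hL, h⟩ := exists_splitting_coord D γ
  intro p q hpq
  have h' : ((p.1, C p.1 + L p.2) : E × (E →L[ℝ] ℝ)) = (q.1, C q.1 + L q.2) :=
    (h p.1 p.2).symm.trans (Eq.trans hpq (h q.1 q.2))
  obtain ⟨h1, h2⟩ := Prod.mk.inj h'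
  rw [h1] at h2
  exact Prod.ext h1 (hL (add_left_cancel h2))

/-- The identification `T_pM ⊕ T_p^*M = T_γ(T^*M)` determined by `D`. -/
def splitting (D : Connection E M) (γ : CotangentBundle E M) :
    (TangentSpace 𝓘(ℝ, E) γ.proj × CotangentSpace E γ.proj) ≃L[ℝ]
      TangentSpace (cotangentModel E) γ :=
  LinearEquiv.toContinuousLinearEquiv <| LinearMap.linearEquivOfInjective
    (splittingMap D γ) (splittingMap_injective D γ) <| by
      change Module.finrank ℝ (E × (E →L[ℝ] ℝ)) = Module.finrank ℝ (E × (E →L[ℝ] ℝ))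
      rfl

/-- The almost complex structure on `T^*M` defined by `D` and by a generalized complex structure
`𝒥` (a field of endomorphisms of `TM ⊕ T^*M`): `𝒥` transported by the splitting. -/
def cotangentLift (D : Connection E M)
    (𝒥 : Π x : M, (TangentSpace 𝓘(ℝ, E) x × CotangentSpace E x) →L[ℝ]
      (TangentSpace 𝓘(ℝ, E) x × CotangentSpace E x)) (γ : CotangentBundle E M) :
    TangentSpace (cotangentModel E) γ →L[ℝ] TangentSpace (cotangentModel E) γ :=
  (splitting D γ : _ →L[ℝ] _) ∘L 𝒥 γ.proj ∘L ((splitting D γ).symm : _ →L[ℝ] _)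

/-- The field of endomorphisms `diag(J, ε J^*)` of `TM ⊕ T^*M`, where `J^* ξ = ξ ∘ J`. -/
def diagGen (J : Π x : M, TangentSpace 𝓘(ℝ, E) x →L[ℝ] TangentSpace 𝓘(ℝ, E) x) (ε : ℝ) (x : M) :
    (TangentSpace 𝓘(ℝ, E) x × CotangentSpace E x) →L[ℝ]
      (TangentSpace 𝓘(ℝ, E) x × CotangentSpace E x) :=
  (J x).prodMap (ε • ContinuousLinearMap.precomp ℝ (J x))

theorem diagGen_apply (J : Π x : M, TangentSpace 𝓘(ℝ, E) x →L[ℝ] TangentSpace 𝓘(ℝ, E) x) (ε : ℝ)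
    (x : M) (v : TangentSpace 𝓘(ℝ, E) x) (ξ : CotangentSpace E x) :
    diagGen J ε x (v, ξ) = (J x v, ε • (ξ ∘L J x)) := rfl

/-- Sanity check: `cotangentLift D (diagGen J ε)` squares to `-Id` if `J` does and `ε = ±1`. -/
theorem cotangentLift_sq (D : Connection E M)
    {J : Π x : M, TangentSpace 𝓘(ℝ, E) x →L[ℝ] TangentSpace 𝓘(ℝ, E) x}
    (hJ : ∀ (x : M) (v : TangentSpace 𝓘(ℝ, E) x), J x (J x v) = -v) {ε : ℝ}
    (hε : ε = 1 ∨ ε = -1) (γ : CotangentBundle E M) (w : TangentSpace (cotangentModel E) γ) :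
    cotangentLift D (diagGen J ε) γ (cotangentLift D (diagGen J ε) γ w) = -w := by
  have h : ∀ p, diagGen J ε γ.proj (diagGen J ε γ.proj p) = -p := by
    rintro ⟨v, ξ⟩
    rw [diagGen_apply, diagGen_apply, hJ]
    refine Prod.ext rfl ?_
    ext u
    rcases hε with rfl | rfl <;> simp [hJ]
  simp only [cotangentLift, ContinuousLinearMap.comp_apply, ContinuousLinearEquiv.coe_coe,
    ContinuousLinearEquiv.symm_apply_apply]
  rw [h, map_neg, ContinuousLinearEquiv.apply_symm_apply]

end CotangentLift

end

open CotangentLift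

/-! Integrability and the three conditions are pointwise identities between tensors, so everything
is computed at the centre of one chart. There the tangent space is literally the model space and the
chart coordinates act as the identity (`chartCoord_self`), so no transport maps remain.

In the chart at a point over `x`, write a covector as `(z, p)`. If `Γ` are the Christoffel symbols
of `D` and `A` is the matrix field of `J`, the horizontal lift of `u` at `(z, p)` is `(u, p ∘ Γ u)`
(`chartCoord_horLift`). The lifted structure is then the explicit matrix field `liftForm Γ A ε`
(`isChartRep_cotangentLift`). For a matrix field with square `-1`, the Nijenhuis bracket expression
depends only on the values of the two vector fields at the point and is given by `nijenhuisForm`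
(`lieBracket_nijenhuis`, `isIntegrable_iff`).

The core is the computation `nijenhuisForm_liftForm`. On the vectors with horizontal parts `u, v`
and vertical parts `q, s`, the base component of the Nijenhuis tensor of the lift is `N(u, v)`, the
tensor of `J`. The fibre component, evaluated at `w`, is `p (Γ (N(u, v)) w)`, plus `p` of the
curvature expression of the third condition, plus `s` of `ε (D_{Ju} J) w - (D_u J)(J w)`, minus the
same with `q` and `v`. Since `p`, `q` and `s` are arbitrary and covectors separate points, vanishing
of the whole means vanishing of `N` and of the coefficients of `s` and `p`. As `D_u J` anticommutes
with `J`, the coefficient of `s` vanishes exactly when `D_u J = ε J D_{Ju} J`.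

The rest identifies the invariant objects with their coordinate forms. One point there needs an
argument, the existence of smooth Christoffel symbols (`exists_isChristoffel`): the regularity of
`D` is applied to global smooth sections, so the coordinate frame is first cut off by a bump
function. -/

noncomputable section

set_option linter.unusedSectionVars false

namespace CotangentLift

/-! ### Vector fields and their brackets in a preferred chart -/

section Chart

variable {E' : Type*} [NormedAddCommGroup E'] [NormedSpace ℝ E'] {H' : Type*}
  [TopologicalSpace H'] {I : ModelWithCorners ℝ E' H'} {N : Type*} [TopologicalSpace N]
  [ChartedSpace H' N] [IsManifold I ∞ N]

variable (I) in
/-- The coordinates, in the preferred chart at `x₀`, of tangent vectors at `y`. -/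
def chartCoord (x₀ y : N) : TangentSpace I y →L[ℝ] E' :=
  (trivializationAt E' (TangentSpace I : N → Type _) x₀).continuousLinearMapAt ℝ y

variable (I) in
/-- The tangent vector at `y` with given coordinates in the preferred chart at `x₀`. -/
def chartVec (x₀ y : N) : E' →L[ℝ] TangentSpace I y :=
  (trivializationAt E' (TangentSpace I : N → Type _) x₀).symmL ℝ y

variable (I) in
/-- The vector field `X` read in the preferred chart at `x₀`. -/
def chartField (x₀ : N) (X : Π x : N, TangentSpace I x) (z : E') : E' :=
  chartCoord I x₀ ((extChartAt I x₀).symm z) (X ((extChartAt I x₀).symm z))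

theorem mem_baseSet_iff {x₀ y : N} :
    y ∈ (trivializationAt E' (TangentSpace I : N → Type _) x₀).baseSet ↔
      y ∈ (extChartAt I x₀).source := by
  rw [TangentBundle.trivializationAt_baseSet, extChartAt_source]

theorem chartCoord_chartVec {x₀ y : N} (hy : y ∈ (extChartAt I x₀).source) (v : E') :
    chartCoord I x₀ y (chartVec I x₀ y v) = v :=
  Trivialization.continuousLinearMapAt_symmL _ (mem_baseSet_iff.2 hy) v

theorem chartVec_chartCoord {x₀ y : N} (hy : y ∈ (extChartAt I x₀).source)
    (v : TangentSpace I y) : chartVec I x₀ y (chartCoord I x₀ y v) = v :=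
  Trivialization.symmL_continuousLinearMapAt _ (mem_baseSet_iff.2 hy) v

theorem chartCoord_injective {x₀ y : N} (hy : y ∈ (extChartAt I x₀).source) :
    Function.Injective (chartCoord I x₀ y) :=
  Function.LeftInverse.injective (chartVec_chartCoord hy)

theorem chartCoord_eq {x₀ y : N} (hy : y ∈ (extChartAt I x₀).source) (v : TangentSpace I y) :
    chartCoord I x₀ y v =
      (trivializationAt E' (TangentSpace I : N → Type _) x₀ (⟨y, v⟩ : TangentBundle I N)).2 := by
  rw [chartCoord, Trivialization.continuousLinearMapAt_apply,
    Trivialization.coe_linearMapAt_of_mem _ (mem_baseSet_iff.2 hy)]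

theorem chartCoord_eq_mfderiv {x₀ y : N} (hy : y ∈ (extChartAt I x₀).source) :
    chartCoord I x₀ y = mfderiv I 𝓘(ℝ, E') (extChartAt I x₀) y :=
  TangentBundle.continuousLinearMapAt_trivializationAt (by rwa [← extChartAt_source I])

/-- The tangent space at `x₀` is by definition the model space, read through the preferred chart at
`x₀`. Hence the coordinate change is from that chart to itself. -/
theorem chartCoord_self (x₀ : N) (v : TangentSpace I x₀) : chartCoord I x₀ x₀ v = v := by
  rw [chartCoord, TangentBundle.continuousLinearMapAt_trivializationAt_eq_core
    (mem_chart_source H' x₀)]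
  exact (tangentBundleCore I N).coordChange_self _ _ (mem_chart_source H' x₀) v

theorem chartVec_self (x₀ : N) (v : E') : chartVec I x₀ x₀ v = v := by
  apply chartCoord_injective (mem_extChartAt_source x₀)
  exact (chartCoord_chartVec (mem_extChartAt_source x₀) v).trans (chartCoord_self x₀ _).symm

theorem chartField_self (x₀ : N) (X : Π x : N, TangentSpace I x) :
    chartField I x₀ X (extChartAt I x₀ x₀) = X x₀ := by
  rw [chartField, extChartAt_to_inv, chartCoord_self]

theorem chartField_apply {x₀ y : N} (hy : y ∈ (extChartAt I x₀).source)
    (X : Π x : N, TangentSpace I x) :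
    chartField I x₀ X (extChartAt I x₀ y) = chartCoord I x₀ y (X y) := by
  rw [chartField, (extChartAt I x₀).left_inv hy]

variable [I.Boundaryless]

theorem eventually_extChartAt_symm (x₀ : N) {P : N → Prop} (h : ∀ᶠ y in 𝓝 x₀, P y) :
    ∀ᶠ z in 𝓝 (extChartAt I x₀ x₀), P ((extChartAt I x₀).symm z) := by
  have := (continuousAt_extChartAt_symm (I := I) x₀).tendsto
  rw [extChartAt_to_inv] at this
  exact this.eventually h

theorem eventually_mem_target (x₀ : N) :
    ∀ᶠ z in 𝓝 (extChartAt I x₀ x₀), z ∈ (extChartAt I x₀).target :=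
  extChartAt_target_mem_nhds x₀

theorem mpullbackWithin_extChartAt_symm {x₀ : N} {z : E'} (hz : z ∈ (extChartAt I x₀).target)
    (X : Π x : N, TangentSpace I x) :
    mpullbackWithin 𝓘(ℝ, E') I (extChartAt I x₀).symm X (Set.range I) z =
      chartField I x₀ X z := by
  have hy := (extChartAt I x₀).map_target hz
  have h := TangentBundle.symmL_trivializationAt (I := I) (x₀ := x₀)
    (x := (extChartAt I x₀).symm z) (by rwa [← extChartAt_source I])
  rw [(extChartAt I x₀).right_inv hz] at h
  rw [mpullbackWithin_apply, chartField]
  congr 1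
  rw [← h]
  refine ContinuousLinearMap.inverse_eq (g := chartCoord I x₀ ((extChartAt I x₀).symm z)) ?_ ?_
  · ext v
    exact chartVec_chartCoord hy v
  · ext v
    exact chartCoord_chartVec hy v

/-- The manifold bracket pulls the fields back along the inverse chart, brackets them in the model
space and transports the result back. The pulled-back fields are the chart fields, and the transport
back is the identity at the centre of the chart. -/
theorem mlieBracket_eq_lieBracket (x₀ : N) (X Y : Π x : N, TangentSpace I x) :
    mlieBracket I X Y x₀ =
      lieBracket ℝ (chartField I x₀ X) (chartField I x₀ Y) (extChartAt I x₀ x₀) := by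
  have hs := mem_extChartAt_source (I := I) x₀
  rw [mlieBracket, mlieBracketWithin_apply]
  have h1 : ∀ X : Π x : N, TangentSpace I x,
      mpullbackWithin 𝓘(ℝ, E') I (extChartAt I x₀).symm X (Set.range I) =ᶠ[
        𝓝 (extChartAt I x₀ x₀)] chartField I x₀ X := fun X ↦ by
    filter_upwards [eventually_mem_target (I := I) x₀] with z hz
    exact mpullbackWithin_extChartAt_symm hz X
  have h2 : lieBracketWithin ℝ
      (mpullbackWithin 𝓘(ℝ, E') I (extChartAt I x₀).symm X (Set.range I) : E' → E')
      (mpullbackWithin 𝓘(ℝ, E') I (extChartAt I x₀).symm Y (Set.range I) : E' → E')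
      ((extChartAt I x₀).symm ⁻¹' Set.univ ∩ Set.range I) (extChartAt I x₀ x₀) =
      lieBracket ℝ (chartField I x₀ X) (chartField I x₀ Y) (extChartAt I x₀ x₀) := by
    -- Without boundary the model range is everything, so the bracket within a set is the ordinary
    -- one.
    refine (lieBracketWithin_of_mem_nhds (by rw [I.range_eq_univ]; simp)).trans ?_
    exact (h1 X).lieBracket_vectorField_eq (𝕜 := ℝ) (h1 Y)
  have h3 : (mfderiv I 𝓘(ℝ, E') (extChartAt I x₀) x₀).inverse = chartVec I x₀ x₀ := by
    rw [← chartCoord_eq_mfderiv hs]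
    exact ContinuousLinearMap.inverse_eq (by ext v; exact chartCoord_chartVec hs v)
      (by ext v; exact chartVec_chartCoord hs v)
  exact (congrArg₂ (fun (L : E' →L[ℝ] TangentSpace I x₀) (w : E') ↦ L w) h3 h2).trans
    (chartVec_self x₀ _)

/-- A section is differentiable near `x₀` iff its chart representation is. -/
theorem mdifferentiableAt_iff_chartField {x₀ y : N} (hy : y ∈ (extChartAt I x₀).source)
    (X : Π x : N, TangentSpace I x) :
    MDiffAt (T% X) y ↔ DifferentiableAt ℝ (chartField I x₀ X) (extChartAt I x₀ y) := by
  set e := trivializationAt E' (TangentSpace I : N → Type _) x₀ with he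
  have hev : ∀ᶠ y' in 𝓝 y, y' ∈ (extChartAt I x₀).source :=
    (isOpen_extChartAt_source x₀).mem_nhds hy
  have hyt := (extChartAt I x₀).map_source hy
  rw [e.mdifferentiableAt_section_iff I X (mem_baseSet_iff.2 hy)]
  constructor
  · intro h
    have h2 : MDifferentiableAt 𝓘(ℝ, E') I (extChartAt I x₀).symm (extChartAt I x₀ y) :=
      ((contMDiffOn_extChartAt_symm (n := 1) x₀).contMDiffAt
        ((isOpen_extChartAt_target x₀).mem_nhds hyt)).mdifferentiableAt one_ne_zero
    have h3 : MDifferentiableAt I 𝓘(ℝ, E') (fun x ↦ (e (⟨x, X x⟩ : TangentBundle I N)).2)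
        ((extChartAt I x₀).symm (extChartAt I x₀ y)) := by
      rwa [(extChartAt I x₀).left_inv hy]
    have h4 := (h3.comp _ h2).differentiableAt
    refine h4.congr_of_eventuallyEq ?_
    filter_upwards [(isOpen_extChartAt_target x₀).mem_nhds hyt] with z hz
    exact chartCoord_eq ((extChartAt I x₀).map_target hz) _
  · intro h
    have h2 : MDifferentiableAt I 𝓘(ℝ, E') (extChartAt I x₀) y :=
      (contMDiffAt_extChartAt' (n := 1)
        (by rwa [← extChartAt_source I])).mdifferentiableAt one_ne_zero
    refine (h.mdifferentiableAt.comp y h2).congr_of_eventuallyEq ?_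
    filter_upwards [hev] with y' hy'
    rw [Function.comp_apply, chartField_apply hy', chartCoord_eq hy']

theorem contDiffAt_chartField {x₀ y : N} (hy : y ∈ (extChartAt I x₀).source)
    {X : Π x : N, TangentSpace I x}
    (h : ContMDiffAt I (I.prod 𝓘(ℝ, E')) ∞ (fun x ↦ (⟨x, X x⟩ : TangentBundle I N)) y) :
    ContDiffAt ℝ ∞ (chartField I x₀ X) (extChartAt I x₀ y) := by
  set e := trivializationAt E' (TangentSpace I : N → Type _) x₀ with he
  have hyt := (extChartAt I x₀).map_source hy
  have h := (e.contMDiffAt_section_iff (mem_baseSet_iff.2 hy)).1 h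
  have h2 : ContMDiffAt 𝓘(ℝ, E') I ∞ (extChartAt I x₀).symm (extChartAt I x₀ y) :=
    (contMDiffOn_extChartAt_symm x₀).contMDiffAt ((isOpen_extChartAt_target x₀).mem_nhds hyt)
  have h3 : ContMDiffAt I 𝓘(ℝ, E') ∞ (fun x ↦ (e (⟨x, X x⟩ : TangentBundle I N)).2)
      ((extChartAt I x₀).symm (extChartAt I x₀ y)) := by
    rwa [(extChartAt I x₀).left_inv hy]
  refine (h3.comp _ h2).contDiffAt.congr_of_eventuallyEq ?_
  filter_upwards [(isOpen_extChartAt_target x₀).mem_nhds hyt] with z hz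
  exact chartCoord_eq ((extChartAt I x₀).map_target hz) _

/-- The vector field with constant coordinates in the preferred chart at `x₀`. -/
theorem smoothVectorFieldOn_chartVec (x₀ : N) (v : E') :
    SmoothVectorFieldOn I (fun y ↦ chartVec I x₀ y v) (extChartAt I x₀).source := by
  intro y hy
  set e := trivializationAt E' (TangentSpace I : N → Type _) x₀ with he
  refine ContMDiffAt.contMDiffWithinAt ((e.contMDiffAt_section_iff (mem_baseSet_iff.2 hy)).2 ?_)
  refine (contMDiffAt_const (c := v)).congr_of_eventuallyEq ?_
  filter_upwards [(isOpen_extChartAt_source (I := I) x₀).mem_nhds hy] with y' hy'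
  rw [← chartCoord_eq hy', chartCoord_chartVec hy']

theorem chartField_chartVec {x₀ : N} {z : E'} (hz : z ∈ (extChartAt I x₀).target) (v : E') :
    chartField I x₀ (fun y ↦ chartVec I x₀ y v) z = v :=
  chartCoord_chartVec ((extChartAt I x₀).map_target hz) v

theorem SmoothVectorFieldOn.contMDiffAt {X : Π x : N, TangentSpace I x} {U : Set N}
    (hX : SmoothVectorFieldOn I X U) (hU : IsOpen U) {x : N} (hx : x ∈ U) :
    ContMDiffAt I (I.prod 𝓘(ℝ, E')) ∞ (fun x ↦ (⟨x, X x⟩ : TangentBundle I N)) x :=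
  ContMDiffOn.contMDiffAt hX (hU.mem_nhds hx)

end Chart

/-! ### The Nijenhuis tensor of a matrix field on a vector space -/

section Nijenhuis

variable {F : Type*} [NormedAddCommGroup F] [NormedSpace ℝ F]

/-- The Nijenhuis tensor, at the point `z` of a vector space, of a field of endomorphisms `A`. -/
def nijenhuisForm (A : F → F →L[ℝ] F) (z a b : F) : F :=
  fderiv ℝ A z (A z a) b - fderiv ℝ A z (A z b) a + A z (fderiv ℝ A z b a)
    - A z (fderiv ℝ A z a b)

theorem fderiv_field_apply {A : F → F →L[ℝ] F} {V : F → F} {z : F} (hA : DifferentiableAt ℝ A z)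
    (hV : DifferentiableAt ℝ V z) (w : F) :
    fderiv ℝ (fun y ↦ A y (V y)) z w = fderiv ℝ A z w (V z) + A z (fderiv ℝ V z w) := by
  rw [fderiv_clm_apply hA hV]
  simp [add_comm]

/-- Expanding by the product rule, all derivatives of `V` and `W` cancel, and only derivatives of
`A` survive. The relation `A² = -1` is needed only at `z`. -/
theorem lieBracket_nijenhuis {A : F → F →L[ℝ] F} {V W : F → F} {z : F}
    (hA : DifferentiableAt ℝ A z) (hsq : ∀ v, A z (A z v) = -v)
    (hV : DifferentiableAt ℝ V z) (hW : DifferentiableAt ℝ W z) :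
    lieBracket ℝ (fun y ↦ A y (V y)) (fun y ↦ A y (W y)) z
      - A z (lieBracket ℝ (fun y ↦ A y (V y)) W z)
      - A z (lieBracket ℝ V (fun y ↦ A y (W y)) z) - lieBracket ℝ V W z =
      nijenhuisForm A z (V z) (W z) := by
  simp only [lieBracket_eq, fderiv_field_apply hA hV, fderiv_field_apply hA hW, map_sub, map_add,
    hsq, nijenhuisForm]
  abel

end Nijenhuis

/-! ### Integrability as vanishing of the coordinate Nijenhuis tensor -/

section IsIntegrable

variable {E' : Type*} [NormedAddCommGroup E'] [NormedSpace ℝ E'] {H' : Type*}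
  [TopologicalSpace H'] {I : ModelWithCorners ℝ E' H'} [I.Boundaryless] {N : Type*}
  [TopologicalSpace N] [ChartedSpace H' N] [IsManifold I ∞ N]

variable (I) in
/-- The field of endomorphisms `J` is represented by `A` in the preferred chart at `x₀`. -/
structure IsChartRep (J : Π x : N, TangentSpace I x →L[ℝ] TangentSpace I x) (x₀ : N)
    (A : E' → E' →L[ℝ] E') : Prop where
  differentiableAt : DifferentiableAt ℝ A (extChartAt I x₀ x₀)
  apply : ∀ᶠ y in 𝓝 x₀, ∀ v : TangentSpace I y,
    chartCoord I x₀ y (J y v) = A (extChartAt I x₀ y) (chartCoord I x₀ y v)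

variable {J : Π x : N, TangentSpace I x →L[ℝ] TangentSpace I x} {x₀ : N} {A : E' → E' →L[ℝ] E'}

theorem IsChartRep.apply_self (hA : IsChartRep I J x₀ A) (v : TangentSpace I x₀) :
    J x₀ v = A (extChartAt I x₀ x₀) v := by
  have := hA.apply.self_of_nhds v
  rwa [chartCoord_self, chartCoord_self] at this

theorem IsChartRep.chartField (hA : IsChartRep I J x₀ A) (X : Π x : N, TangentSpace I x) :
    chartField I x₀ (fun y ↦ J y (X y)) =ᶠ[𝓝 (extChartAt I x₀ x₀)]
      fun z ↦ A z (CotangentLift.chartField I x₀ X z) := by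
  filter_upwards [eventually_extChartAt_symm x₀ hA.apply, eventually_mem_target (I := I) x₀]
    with z hz hz'
  rw [CotangentLift.chartField, hz, (extChartAt I x₀).right_inv hz', CotangentLift.chartField]

theorem nijenhuis_eq_nijenhuisForm (hA : IsChartRep I J x₀ A)
    (hsq : ∀ v : TangentSpace I x₀, J x₀ (J x₀ v) = -v) {X Y : Π x : N, TangentSpace I x}
    (hX : MDiffAt (T% X) x₀) (hY : MDiffAt (T% Y) x₀) :
    nijenhuis I J X Y x₀ = nijenhuisForm A (extChartAt I x₀ x₀) (X x₀) (Y x₀) := by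
  have hs := mem_extChartAt_source (I := I) x₀
  rw [mdifferentiableAt_iff_chartField hs] at hX hY
  have hsq' : ∀ v : E', A (extChartAt I x₀ x₀) (A (extChartAt I x₀ x₀) v) = -v := fun v ↦ by
    have h := hsq v
    rw [hA.apply_self] at h
    exact (congrArg (A _) (hA.apply_self v)).symm.trans h
  have key := lieBracket_nijenhuis hA.differentiableAt hsq' hX hY
  have hr : ∀ X : Π x : N, TangentSpace I x, CotangentLift.chartField I x₀ X
    =ᶠ[𝓝 (extChartAt I x₀ x₀)] CotangentLift.chartField I x₀ X := fun X ↦ Filter.EventuallyEq.rfl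
  rw [← (hA.chartField X).lieBracket_vectorField_eq (hA.chartField Y),
    ← (hA.chartField X).lieBracket_vectorField_eq (hr Y),
    ← (hr X).lieBracket_vectorField_eq (hA.chartField Y), chartField_self, chartField_self] at key
  simp only [← mlieBracket_eq_lieBracket] at key
  refine Eq.trans ?_ key
  rw [nijenhuis, hA.apply_self, hA.apply_self]
  rfl

/-- By tensoriality only the values of the fields at the point matter, and fields with constant
coordinates realise every pair of values. -/
theorem isIntegrable_iff {A : N → E' → E' →L[ℝ] E'} (hA : ∀ x₀, IsChartRep I J x₀ (A x₀))
    (hsq : ∀ (x : N) (v : TangentSpace I x), J x (J x v) = -v) :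
    IsIntegrable I J ↔
      ∀ (x₀ : N) (a b : E'), nijenhuisForm (A x₀) (extChartAt I x₀ x₀) a b = 0 := by
  constructor
  · intro h x₀ a b
    have hs := mem_extChartAt_source (I := I) x₀
    have hsm := smoothVectorFieldOn_chartVec (I := I) x₀
    have hm := fun v ↦ ((hsm v).contMDiffAt (isOpen_extChartAt_source x₀) hs).mdifferentiableAt
      (by simp)
    have := h _ (isOpen_extChartAt_source x₀) _ _ (hsm a) (hsm b) x₀ hs
    rw [nijenhuis_eq_nijenhuisForm (hA x₀) (hsq x₀) (hm a) (hm b), chartVec_self,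
      chartVec_self] at this
    exact this
  · intro h U hU X Y hX hY x hx
    rw [nijenhuis_eq_nijenhuisForm (hA x) (hsq x)
      ((hX.contMDiffAt hU hx).mdifferentiableAt (by simp))
      ((hY.contMDiffAt hU hx).mdifferentiableAt (by simp))]
    exact h x _ _

end IsIntegrable

/-! ### Endomorphism fields and derivatives of functions in a chart -/

section ChartEnd

variable {E' : Type*} [NormedAddCommGroup E'] [NormedSpace ℝ E'] {H' : Type*}
  [TopologicalSpace H'] {I : ModelWithCorners ℝ E' H'} [I.Boundaryless] {N : Type*}
  [TopologicalSpace N] [ChartedSpace H' N] [IsManifold I ∞ N]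

variable (I) in
/-- The field of endomorphisms `T` read in the preferred chart at `x₀`. -/
def chartEnd (x₀ : N) (T : Π x : N, TangentSpace I x →L[ℝ] TangentSpace I x) (z : E') :
    E' →L[ℝ] E' :=
  (chartCoord I x₀ ((extChartAt I x₀).symm z)) ∘L T ((extChartAt I x₀).symm z) ∘L
    chartVec I x₀ ((extChartAt I x₀).symm z)

theorem chartEnd_apply {x₀ y : N} (hy : y ∈ (extChartAt I x₀).source)
    (T : Π x : N, TangentSpace I x →L[ℝ] TangentSpace I x) (v : TangentSpace I y) :
    chartEnd I x₀ T (extChartAt I x₀ y) (chartCoord I x₀ y v) = chartCoord I x₀ y (T y v) := by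
  rw [chartEnd, (extChartAt I x₀).left_inv hy]
  simp [chartVec_chartCoord hy]

theorem contDiffAt_chartEnd {x₀ : N} {T : Π x : N, TangentSpace I x →L[ℝ] TangentSpace I x}
    (hT : ContMDiffAt I (I.prod 𝓘(ℝ, E' →L[ℝ] E')) ∞
      (fun x ↦ TotalSpace.mk' (E' →L[ℝ] E')
        (E := fun x : N ↦ TangentSpace I x →L[ℝ] TangentSpace I x) x (T x)) x₀) :
    ContDiffAt ℝ ∞ (chartEnd I x₀ T) (extChartAt I x₀ x₀) := by
  have h := ((contMDiffAt_hom_bundle _).1 hT).2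
  have h2 : ContMDiffAt 𝓘(ℝ, E') I ∞ (extChartAt I x₀).symm (extChartAt I x₀ x₀) :=
    (contMDiffOn_extChartAt_symm x₀).contMDiffAt
      ((isOpen_extChartAt_target x₀).mem_nhds (mem_extChartAt_target x₀))
  -- The coordinates of a section of the endomorphism bundle, composed with the inverse chart,
  -- unfold to `chartEnd`.
  exact (h.comp_of_eq h2 (extChartAt_to_inv x₀)).contDiffAt

theorem isChartRep_chartEnd {J : Π x : N, TangentSpace I x →L[ℝ] TangentSpace I x}
    (hJ : IsAlmostComplex I J) (x₀ : N) : IsChartRep I J x₀ (chartEnd I x₀ J) where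
  differentiableAt := (contDiffAt_chartEnd (hJ.smooth x₀)).differentiableAt (by simp)
  apply := by
    filter_upwards [(isOpen_extChartAt_source (I := I) x₀).mem_nhds (mem_extChartAt_source x₀)]
      with y hy v
    rw [chartEnd_apply hy]

theorem mfderiv_eq_fderiv_comp_chartCoord {F : Type*} [NormedAddCommGroup F] [NormedSpace ℝ F]
    {x₀ y : N} (hy : y ∈ (extChartAt I x₀).source) {g : N → F}
    (hg : MDifferentiableAt I 𝓘(ℝ, F) g y) :
    DifferentiableAt ℝ (g ∘ (extChartAt I x₀).symm) (extChartAt I x₀ y) ∧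
    ∀ v : TangentSpace I y, mfderiv I 𝓘(ℝ, F) g y v =
      fderiv ℝ (g ∘ (extChartAt I x₀).symm) (extChartAt I x₀ y) (chartCoord I x₀ y v) := by
  have hyt := (extChartAt I x₀).map_source hy
  have h2 : MDifferentiableAt 𝓘(ℝ, E') I (extChartAt I x₀).symm (extChartAt I x₀ y) :=
    ((contMDiffOn_extChartAt_symm (n := 1) x₀).contMDiffAt
      ((isOpen_extChartAt_target x₀).mem_nhds hyt)).mdifferentiableAt one_ne_zero
  have h3 : MDifferentiableAt 𝓘(ℝ, E') 𝓘(ℝ, F) (g ∘ (extChartAt I x₀).symm) (extChartAt I x₀ y) :=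
    MDifferentiableAt.comp (I' := I) _ (by rwa [(extChartAt I x₀).left_inv hy]) h2
  have h4 : MDifferentiableAt I 𝓘(ℝ, E') (extChartAt I x₀) y :=
    (contMDiffAt_extChartAt' (n := 1)
      (by rwa [← extChartAt_source I])).mdifferentiableAt one_ne_zero
  refine ⟨h3.differentiableAt, fun v ↦ ?_⟩
  have h5 : g =ᶠ[𝓝 y] (g ∘ (extChartAt I x₀).symm) ∘ extChartAt I x₀ := by
    filter_upwards [(isOpen_extChartAt_source (I := I) x₀).mem_nhds hy] with y' hy'
    rw [Function.comp_apply, Function.comp_apply, (extChartAt I x₀).left_inv hy']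
  have h6 := (h3.hasMFDerivAt.comp y h4.hasMFDerivAt).congr_of_eventuallyEq h5
  rw [h6.mfderiv, ← chartCoord_eq_mfderiv hy, mfderiv_eq_fderiv]
  rfl

end ChartEnd

/-! ### Coordinate expressions for the derivative of `J` and the curvature -/

section Forms

variable {F : Type*} [NormedAddCommGroup F] [NormedSpace ℝ F]

/-- The coordinate expression of `(D_u J)(w)`. -/
def covEndForm (Γ : F → F →L[ℝ] F →L[ℝ] F) (A : F → F →L[ℝ] F) (z u w : F) : F :=
  fderiv ℝ A z u w + Γ z u (A z w) - A z (Γ z u w)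

/-- The coordinate expression of the curvature `R_{u,v} w`. -/
def curvForm (Γ : F → F →L[ℝ] F →L[ℝ] F) (z u v w : F) : F :=
  - fderiv ℝ Γ z u v w + fderiv ℝ Γ z v u w - Γ z u (Γ z v w) + Γ z v (Γ z u w)

theorem covEndForm_eq {Γ : F → F →L[ℝ] F →L[ℝ] F} {A : F → F →L[ℝ] F} {Y : F → F} {z : F}
    (hA : DifferentiableAt ℝ A z) (hY : DifferentiableAt ℝ Y z) (u : F) :
    fderiv ℝ (fun y ↦ A y (Y y)) z u + Γ z u (A z (Y z)) -
      A z (fderiv ℝ Y z u + Γ z u (Y z)) = covEndForm Γ A z u (Y z) := by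
  rw [fderiv_field_apply hA hY, covEndForm, map_add]
  abel

theorem fderiv_covariant {Γ : F → F →L[ℝ] F →L[ℝ] F} {Y Z : F → F} {z : F}
    (hΓ : DifferentiableAt ℝ Γ z) (hY : DifferentiableAt ℝ Y z) (hZ : DifferentiableAt ℝ Z z)
    (hZ' : DifferentiableAt ℝ (fderiv ℝ Z) z) (u : F) :
    fderiv ℝ (fun y ↦ fderiv ℝ Z y (Y y) + Γ y (Y y) (Z y)) z u =
      fderiv ℝ (fderiv ℝ Z) z u (Y z) + fderiv ℝ Z z (fderiv ℝ Y z u) +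
      fderiv ℝ Γ z u (Y z) (Z z) + Γ z (fderiv ℝ Y z u) (Z z) + Γ z (Y z) (fderiv ℝ Z z u) := by
  rw [fderiv_fun_add (hZ'.clm_apply hY) ((hΓ.clm_apply hY).clm_apply hZ), add_apply,
    fderiv_field_apply hZ' hY, fderiv_field_apply (hΓ.clm_apply hY) hZ, fderiv_clm_apply hΓ hY]
  simp
  abel

/-- The second derivatives of `Z` cancel by symmetry, and the bracket term absorbs the derivatives
of `X` and `Y`. No symmetry of `Γ` enters, so torsion is allowed. -/
theorem curvForm_eq {Γ : F → F →L[ℝ] F →L[ℝ] F} {X Y Z : F → F} {z : F}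
    (hΓ : DifferentiableAt ℝ Γ z) (hX : DifferentiableAt ℝ X z) (hY : DifferentiableAt ℝ Y z)
    (hZ : ContDiffAt ℝ ∞ Z z) :
    -(fderiv ℝ (fun y ↦ fderiv ℝ Z y (Y y) + Γ y (Y y) (Z y)) z (X z)
        + Γ z (X z) (fderiv ℝ Z z (Y z) + Γ z (Y z) (Z z)))
      + (fderiv ℝ (fun y ↦ fderiv ℝ Z y (X y) + Γ y (X y) (Z y)) z (Y z)
        + Γ z (Y z) (fderiv ℝ Z z (X z) + Γ z (X z) (Z z)))
      + (fderiv ℝ Z z (lieBracket ℝ X Y z) + Γ z (lieBracket ℝ X Y z) (Z z)) =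
      curvForm Γ z (X z) (Y z) (Z z) := by
  have hZd : DifferentiableAt ℝ Z z := hZ.differentiableAt (by simp)
  have hZdd : DifferentiableAt ℝ (fderiv ℝ Z) z :=
    (hZ.fderiv_right (m := ∞) (by simp)).differentiableAt (by simp)
  -- Over the reals, class `C²` suffices for symmetry of the second derivative.
  have hsymm : IsSymmSndFDerivAt ℝ Z z := hZ.isSymmSndFDerivAt (by
    simpa using WithTop.coe_le_coe.2 (le_top (a := (2 : ℕ∞))))
  rw [fderiv_covariant hΓ hX hZd hZdd, fderiv_covariant hΓ hY hZd hZdd, hsymm (Y z) (X z),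
    curvForm, lieBracket_eq]
  simp only [map_sub, map_add, sub_apply]
  abel

end Forms

/-! ### Christoffel symbols, and the invariant tensors in terms of them -/

section Christoffel

variable {E : Type*} [NormedAddCommGroup E] [NormedSpace ℝ E] [FiniteDimensional ℝ E]
  {M : Type*} [TopologicalSpace M] [ChartedSpace E M] [IsManifold 𝓘(ℝ, E) ∞ M]

/-- `Γ` are the (smooth) Christoffel symbols of `D` in the preferred chart at `x₀`. -/
structure IsChristoffel (D : Connection E M) (x₀ : M) (Γ : E → E →L[ℝ] E →L[ℝ] E) : Prop where
  contDiffAt : ContDiffAt ℝ ∞ Γ (extChartAt 𝓘(ℝ, E) x₀ x₀)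
  apply : ∀ᶠ y in 𝓝 x₀, ∀ (Y : Π x : M, TangentSpace 𝓘(ℝ, E) x), MDiffAt (T% Y) y →
    ∀ v : TangentSpace 𝓘(ℝ, E) y, chartCoord 𝓘(ℝ, E) x₀ y (D Y y v) =
      fderiv ℝ (chartField 𝓘(ℝ, E) x₀ Y) (extChartAt 𝓘(ℝ, E) x₀ y) (chartCoord 𝓘(ℝ, E) x₀ y v)
        + Γ (extChartAt 𝓘(ℝ, E) x₀ y) (chartCoord 𝓘(ℝ, E) x₀ y v)
          (chartCoord 𝓘(ℝ, E) x₀ y (Y y))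

/-- Both `D` and the flat derivative of the chart satisfy the Leibniz rule, so the terms `df(v) Y`
cancel in the difference. The difference is therefore determined by the value of `Y` at `y`, which
is what makes Christoffel symbols possible. -/
theorem tensorialAt_connection_sub_fderiv (D : Connection E M) {x₀ y : M}
    (hy : y ∈ (extChartAt 𝓘(ℝ, E) x₀).source) (v : TangentSpace 𝓘(ℝ, E) y) :
    TensorialAt 𝓘(ℝ, E) E (fun Y : Π x : M, TangentSpace 𝓘(ℝ, E) x ↦
      chartCoord 𝓘(ℝ, E) x₀ y (D Y y v) - fderiv ℝ (chartField 𝓘(ℝ, E) x₀ Y)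
        (extChartAt 𝓘(ℝ, E) x₀ y) (chartCoord 𝓘(ℝ, E) x₀ y v)) y where
  smul {f Y} hf hY := by
    have h := (mdifferentiableAt_iff_chartField hy Y).1 hY
    obtain ⟨h1, h2⟩ := mfderiv_eq_fderiv_comp_chartCoord hy hf
    have h3 : chartField 𝓘(ℝ, E) x₀ (f • Y) = fun z ↦
        (f ∘ (extChartAt 𝓘(ℝ, E) x₀).symm) z • chartField 𝓘(ℝ, E) x₀ Y z := by
      ext z
      exact (chartCoord 𝓘(ℝ, E) x₀ _).map_smul _ _
    have h4 : d% f y v = _ := h2 v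
    have h5 : (f ∘ (extChartAt 𝓘(ℝ, E) x₀).symm) (extChartAt 𝓘(ℝ, E) x₀ y) = f y := by
      rw [Function.comp_apply, (extChartAt 𝓘(ℝ, E) x₀).left_inv hy]
    rw [h3, D.isCovariantDerivativeOnUniv.leibniz hY hf, fderiv_fun_smul h1 h, h5,
      chartField_apply hy]
    simp only [add_apply, smul_apply, ContinuousLinearMap.smulRight_apply, map_add, map_smul, h4]
    module
  add {Y Y'} hY hY' := by
    have h := (mdifferentiableAt_iff_chartField hy Y).1 hY
    have h' := (mdifferentiableAt_iff_chartField hy Y').1 hY'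
    have h3 : chartField 𝓘(ℝ, E) x₀ (Y + Y') = fun z ↦
        chartField 𝓘(ℝ, E) x₀ Y z + chartField 𝓘(ℝ, E) x₀ Y' z := by
      ext z
      exact (chartCoord 𝓘(ℝ, E) x₀ _).map_add _ _
    rw [h3, D.isCovariantDerivativeOnUniv.add hY hY', fderiv_fun_add h h']
    simp only [add_apply, map_add]
    abel

/-- The coordinate frame times a bump function gives global smooth sections `s i`, to which the
smoothness of `D` applies. Near `x₀` they have constant coordinates, so `D (s i)` is exactly the
`i`-th Christoffel part. -/
theorem exists_isChristoffel [T2Space M] (D : Connection E M)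
    [hD : CovariantDerivative.ContMDiffCovariantDerivative D ∞] (x₀ : M) :
    ∃ Γ, IsChristoffel D x₀ Γ := by
  let b := Module.finBasis ℝ E
  let ψ : SmoothBumpFunction 𝓘(ℝ, E) x₀ := Classical.choice inferInstance
  let s : Fin (Module.finrank ℝ E) → Π x : M, TangentSpace 𝓘(ℝ, E) x :=
    fun i y ↦ ψ y • chartVec 𝓘(ℝ, E) x₀ y (b i)
  have hs : ∀ i, ContMDiff 𝓘(ℝ, E) (𝓘(ℝ, E).prod 𝓘(ℝ, E)) ∞
      (fun x ↦ (⟨x, s i x⟩ : TangentBundle 𝓘(ℝ, E) M)) := by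
    intro i y
    by_cases hy : y ∈ (extChartAt 𝓘(ℝ, E) x₀).source
    · exact ψ.contMDiffAt.smul_section
        ((smoothVectorFieldOn_chartVec x₀ (b i)).contMDiffAt (isOpen_extChartAt_source x₀) hy)
    -- Off the chart domain `chartVec` carries no information, but the bump function vanishes near
    -- `y`, so the section is locally zero.
    · have h1 : y ∉ tsupport ψ := fun h ↦ hy (ψ.tsupport_subset_extChartAt_source h)
      have h2 := (contMDiff_zeroSection ℝ (TangentSpace 𝓘(ℝ, E) : M → Type _)
        (n := ∞) (IB := 𝓘(ℝ, E)) (F := E)) y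
      refine h2.congr_of_eventuallyEq ?_
      filter_upwards [(isClosed_tsupport _).isOpen_compl.mem_nhds h1] with y' hy'
      have : ψ y' = 0 := image_eq_zero_of_notMem_tsupport hy'
      simp [s, this, zeroSection]
  let T := fun i ↦ chartEnd 𝓘(ℝ, E) x₀ (D (s i))
  have hT : ∀ i, ContDiffAt ℝ ∞ (T i) (extChartAt 𝓘(ℝ, E) x₀ x₀) := fun i ↦
    contDiffAt_chartEnd (hD.contMDiff.contMDiff (hs i).contMDiffOn |>.contMDiffAt Filter.univ_mem)
  -- This is `Γ z u w = ∑ i, bⁱ(w) • T i z u`, with `bⁱ` the dual basis.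
  refine ⟨fun z ↦ ∑ i, (ContinuousLinearMap.smulRightL ℝ E E
    (b.coord i).toContinuousLinearMap) ∘L T i z, ?_, ?_⟩
  · exact ContDiffAt.sum fun i _ ↦ contDiffAt_const.clm_comp (hT i)
  -- Here `ψ = 1` is required on a neighbourhood of `y`, not only at `y`, because the sections `s i`
  -- get differentiated there.
  · filter_upwards [ψ.eventuallyEq_one.eventually_nhds,
      (isOpen_extChartAt_source (I := 𝓘(ℝ, E)) x₀).mem_nhds (mem_extChartAt_source x₀)]
      with y hψ hy Y hY v
    have hten := tensorialAt_connection_sub_fderiv D hy v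
    set w := chartCoord 𝓘(ℝ, E) x₀ y (Y y) with hw
    have hsd : ∀ i, MDiffAt (T% (s i)) y := fun i ↦ (hs i y).mdifferentiableAt (by simp)
    have hcd : ∀ i, MDiffAt (T% ((fun _ : M ↦ b.coord i w) • s i)) y := fun i ↦
      mdifferentiableAt_const.smul_section (hsd i)
    have h1 := hten.sum (s := Finset.univ) (fun i ↦ (fun _ : M ↦ b.coord i w) • s i)
      fun i _ ↦ hcd i
    -- By tensoriality `Y` may be replaced by the combination of the `s i` with constant
    -- coefficients that agrees with it at `y`.
    have h2 := hten.pointwise hY (MDifferentiableAt.sum_section (t := fun i ↦ (fun _ : M ↦ b.coord i w) • s i) (s := Finset.univ) fun i _ ↦ hcd i) (by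
      apply chartCoord_injective hy
      have : ψ y = 1 := hψ.self_of_nhds
      simp only [Pi.smul_apply', s, this, one_smul, map_sum, map_smul, chartCoord_chartVec hy]
      exact (b.sum_repr w).symm)
    rw [h1] at h2
    rw [← sub_eq_iff_eq_add', h2]
    simp only [sum_apply, ContinuousLinearMap.comp_apply]
    refine Finset.sum_congr rfl fun i _ ↦ ?_
    rw [hten.smul mdifferentiableAt_const (hsd i)]
    have h3 : chartField 𝓘(ℝ, E) x₀ (s i) =ᶠ[𝓝 (extChartAt 𝓘(ℝ, E) x₀ y)] fun _ ↦ b i := by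
      have hc := continuousAt_extChartAt_symm' (I := 𝓘(ℝ, E)) hy
      rw [ContinuousAt, (extChartAt 𝓘(ℝ, E) x₀).left_inv hy] at hc
      filter_upwards [(isOpen_extChartAt_target x₀).mem_nhds
        ((extChartAt 𝓘(ℝ, E) x₀).map_source hy), hc.eventually hψ] with z hz hz'
      have hz' : ψ ((extChartAt 𝓘(ℝ, E) x₀).symm z) = 1 := hz'
      simp only [chartField, s, hz', one_smul]
      exact chartCoord_chartVec ((extChartAt 𝓘(ℝ, E) x₀).map_target hz) _
    rw [h3.fderiv_eq]
    have h4 := chartEnd_apply hy (D (s i)) v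
    simp only [T, h4]
    simp

variable {D : Connection E M} {x₀ : M} {Γ : E → E →L[ℝ] E →L[ℝ] E}

theorem IsChristoffel.apply_self (hΓ : IsChristoffel D x₀ Γ)
    {Y : Π x : M, TangentSpace 𝓘(ℝ, E) x} (hY : MDiffAt (T% Y) x₀)
    (v : TangentSpace 𝓘(ℝ, E) x₀) :
    D Y x₀ v = (fderiv ℝ (chartField 𝓘(ℝ, E) x₀ Y) (extChartAt 𝓘(ℝ, E) x₀ x₀) v
        + Γ (extChartAt 𝓘(ℝ, E) x₀ x₀) v (Y x₀) : E) := by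
  have := hΓ.apply.self_of_nhds Y hY v
  rwa [chartCoord_self, chartCoord_self, chartCoord_self] at this

variable {J : Π x : M, TangentSpace 𝓘(ℝ, E) x →L[ℝ] TangentSpace 𝓘(ℝ, E) x}
  {A : E → E →L[ℝ] E}

theorem IsChartRep.mdifferentiableAt (hA : IsChartRep 𝓘(ℝ, E) J x₀ A)
    {Y : Π x : M, TangentSpace 𝓘(ℝ, E) x} (hY : MDiffAt (T% Y) x₀) :
    MDiffAt (T% (fun y ↦ J y (Y y))) x₀ := by
  have hs := mem_extChartAt_source (I := 𝓘(ℝ, E)) x₀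
  rw [mdifferentiableAt_iff_chartField hs] at hY ⊢
  exact (hA.differentiableAt.clm_apply hY).congr_of_eventuallyEq (hA.chartField Y)

theorem covDerivEnd_eq_covEndForm (hΓ : IsChristoffel D x₀ Γ) (hA : IsChartRep 𝓘(ℝ, E) J x₀ A)
    (X : Π x : M, TangentSpace 𝓘(ℝ, E) x) {Y : Π x : M, TangentSpace 𝓘(ℝ, E) x}
    (hY : MDiffAt (T% Y) x₀) :
    covDerivEnd D J X Y x₀ = covEndForm Γ A (extChartAt 𝓘(ℝ, E) x₀ x₀) (X x₀) (Y x₀) := by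
  have hs := mem_extChartAt_source (I := 𝓘(ℝ, E)) x₀
  have hY' := (mdifferentiableAt_iff_chartField hs Y).1 hY
  have key := covEndForm_eq (Γ := Γ) hA.differentiableAt hY' (X x₀)
  rw [← (hA.chartField Y).fderiv_eq, chartField_self] at key
  rw [covDerivEnd, hA.apply_self (D Y x₀ (X x₀)), hΓ.apply_self hY,
    hΓ.apply_self (hA.mdifferentiableAt hY), hA.apply_self]
  exact key

theorem IsChristoffel.chartField (hΓ : IsChristoffel D x₀ Γ)
    {Z : Π x : M, TangentSpace 𝓘(ℝ, E) x} (hZ : ∀ᶠ y in 𝓝 x₀, MDiffAt (T% Z) y)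
    (Y : Π x : M, TangentSpace 𝓘(ℝ, E) x) :
    chartField 𝓘(ℝ, E) x₀ (fun y ↦ D Z y (Y y)) =ᶠ[𝓝 (extChartAt 𝓘(ℝ, E) x₀ x₀)] fun z ↦
      fderiv ℝ (chartField 𝓘(ℝ, E) x₀ Z) z (chartField 𝓘(ℝ, E) x₀ Y z) +
        Γ z (chartField 𝓘(ℝ, E) x₀ Y z) (chartField 𝓘(ℝ, E) x₀ Z z) := by
  filter_upwards [eventually_extChartAt_symm x₀ hΓ.apply, eventually_extChartAt_symm x₀ hZ,
    eventually_mem_target (I := 𝓘(ℝ, E)) x₀] with z hz hz' hz''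
  rw [CotangentLift.chartField, hz Z hz', (extChartAt 𝓘(ℝ, E) x₀).right_inv hz'']
  rfl

/-- `Z` must be differentiable on a neighbourhood, since the inner covariant derivative is itself
differentiated. For `X` and `Y` differentiability at the point is enough. -/
theorem curvature_eq_curvForm (hΓ : IsChristoffel D x₀ Γ)
    {X Y Z : Π x : M, TangentSpace 𝓘(ℝ, E) x} (hX : MDiffAt (T% X) x₀) (hY : MDiffAt (T% Y) x₀)
    (hZ : ∀ᶠ y in 𝓝 x₀, MDiffAt (T% Z) y)
    (hZ' : ContDiffAt ℝ ∞ (chartField 𝓘(ℝ, E) x₀ Z) (extChartAt 𝓘(ℝ, E) x₀ x₀)) :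
    curvature D X Y Z x₀ =
      curvForm Γ (extChartAt 𝓘(ℝ, E) x₀ x₀) (X x₀) (Y x₀) (Z x₀) := by
  have hs := mem_extChartAt_source (I := 𝓘(ℝ, E)) x₀
  have hΓd := hΓ.contDiffAt.differentiableAt (by simp)
  have hX' := (mdifferentiableAt_iff_chartField hs X).1 hX
  have hY' := (mdifferentiableAt_iff_chartField hs Y).1 hY
  have hZd := hZ'.differentiableAt (by simp)
  have hZdd := (hZ'.fderiv_right (m := ∞) (by simp)).differentiableAt (by simp)
  have hm : ∀ Y : Π x : M, TangentSpace 𝓘(ℝ, E) x, MDiffAt (T% Y) x₀ →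
      MDiffAt (T% (fun y ↦ D Z y (Y y))) x₀ := fun Y hY ↦ by
    have hY' := (mdifferentiableAt_iff_chartField hs Y).1 hY
    exact (mdifferentiableAt_iff_chartField hs _).2
      (((hZdd.clm_apply hY').add ((hΓd.clm_apply hY').clm_apply hZd)).congr_of_eventuallyEq
        (hΓ.chartField hZ Y))
  have key := curvForm_eq hΓd hX' hY' hZ'
  rw [← (hΓ.chartField hZ X).fderiv_eq, ← (hΓ.chartField hZ Y).fderiv_eq,
    ← mlieBracket_eq_lieBracket, chartField_self, chartField_self, chartField_self] at key
  rw [curvature, hΓ.apply_self (hm X hX), hΓ.apply_self (hm Y hY),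
    hΓ.apply_self hZ.self_of_nhds, hΓ.apply_self hZ.self_of_nhds, hΓ.apply_self hZ.self_of_nhds]
  exact key

end Christoffel

/-! ### Horizontal and vertical lifts in the charts of the cotangent manifold -/

section CotangentChart

variable {E : Type*} [NormedAddCommGroup E] [NormedSpace ℝ E] [FiniteDimensional ℝ E]
  {M : Type*} [TopologicalSpace M] [ChartedSpace E M] [IsManifold 𝓘(ℝ, E) ∞ M]

/-- The coordinates, in the preferred chart at `x₀`, of covectors at `y`. -/
def covecCoord (x₀ y : M) : CotangentSpace E y →L[ℝ] E →L[ℝ] ℝ :=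
  ContinuousLinearMap.precomp ℝ (chartVec 𝓘(ℝ, E) x₀ y)

theorem covecCoord_apply (x₀ y : M) (ξ : CotangentSpace E y) (w : E) :
    covecCoord x₀ y ξ w = ξ (chartVec 𝓘(ℝ, E) x₀ y w) := rfl

/-- The `1`-form `α` read in the preferred chart at `x₀`. -/
def chartForm (x₀ : M) (α : Π x : M, CotangentSpace E x) (z : E) : E →L[ℝ] ℝ :=
  covecCoord x₀ ((extChartAt 𝓘(ℝ, E) x₀).symm z) (α ((extChartAt 𝓘(ℝ, E) x₀).symm z))

theorem trivializationAt_cotangent {x₀ : M} (γ : CotangentBundle E M) :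
    (trivializationAt (E →L[ℝ] ℝ) (CotangentSpace E) x₀ γ).2 = covecCoord x₀ γ.proj γ.snd := by
  have := hom_trivializationAt_apply (RingHom.id ℝ) (F₁ := E)
      (E₁ := (TangentSpace 𝓘(ℝ, E) : M → Type _)) (F₂ := ℝ) (E₂ := Bundle.Trivial M ℝ) x₀ γ
  refine (congrArg Prod.snd this).trans ?_
  ext w
  simp only [ContinuousLinearMap.inCoordinates, ContinuousLinearMap.comp_apply]
  simp [covecCoord_apply, chartVec]

theorem extChartAt_cotangent (γ₀ : CotangentBundle E M) {γ : CotangentBundle E M}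
    (hγ : γ.proj ∈ (extChartAt 𝓘(ℝ, E) γ₀.proj).source) :
    extChartAt (cotangentModel E) γ₀ γ =
      (extChartAt 𝓘(ℝ, E) γ₀.proj γ.proj, covecCoord γ₀.proj γ.proj γ.snd) := by
  set e := trivializationAt (E →L[ℝ] ℝ) (CotangentSpace E) γ₀.proj with he
  have hb : γ.proj ∈ e.baseSet := by
    rw [he, hom_trivializationAt_baseSet]
    exact ⟨mem_baseSet_iff.2 hγ, Set.mem_univ _⟩
  rw [FiberBundle.extChartAt]
  change (extChartAt 𝓘(ℝ, E) γ₀.proj (e γ).1, (e γ).2) = _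
  rw [e.coe_fst' hb, trivializationAt_cotangent]

theorem mem_extChartAt_source_cotangent (γ₀ : CotangentBundle E M) {γ : CotangentBundle E M}
    (hγ : γ.proj ∈ (extChartAt 𝓘(ℝ, E) γ₀.proj).source) :
    γ ∈ (extChartAt (cotangentModel E) γ₀).source := by
  set e := trivializationAt (E →L[ℝ] ℝ) (CotangentSpace E) γ₀.proj with he
  have hb : γ.proj ∈ e.baseSet := by
    rw [he, hom_trivializationAt_baseSet]
    exact ⟨mem_baseSet_iff.2 hγ, Set.mem_univ _⟩
  rw [FiberBundle.extChartAt]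
  simp only [mfld_simps]
  rw [← he, e.coe_fst' hb]
  exact ⟨hb, by rwa [extChartAt_source] at hγ⟩

theorem chartCoord_mfderiv {E' : Type*} [NormedAddCommGroup E'] [NormedSpace ℝ E']
    {H' : Type*} [TopologicalSpace H'] {I : ModelWithCorners ℝ E' H'} {N : Type*}
    [TopologicalSpace N] [ChartedSpace H' N] {f : N → CotangentBundle E M} {x : N}
    (hf : MDifferentiableAt I (cotangentModel E) f x) {γ₀ γ : CotangentBundle E M}
    (hγ : γ.proj ∈ (extChartAt 𝓘(ℝ, E) γ₀.proj).source) (hfx : f x = γ) (v : E') :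
    chartCoord (cotangentModel E) γ₀ γ (mfderiv I (cotangentModel E) f x v :
        E × (E →L[ℝ] ℝ)) =
      mfderiv I 𝓘(ℝ, E × (E →L[ℝ] ℝ)) (fun y ↦ extChartAt (cotangentModel E) γ₀ (f y)) x v := by
  subst hfx
  have hs := mem_extChartAt_source_cotangent γ₀ hγ
  have h4 : MDifferentiableAt (cotangentModel E) 𝓘(ℝ, E × (E →L[ℝ] ℝ))
      (extChartAt (cotangentModel E) γ₀) (f x) :=
    (contMDiffAt_extChartAt' (n := 1)
      (by rwa [← extChartAt_source (cotangentModel E)])).mdifferentiableAt one_ne_zero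
  rw [chartCoord_eq_mfderiv hs]
  exact (DFunLike.congr_fun (h4.hasMFDerivAt.comp x hf.hasMFDerivAt).mfderiv v).symm

theorem chartCoord_vertLift {γ₀ γ : CotangentBundle E M}
    (hγ : γ.proj ∈ (extChartAt 𝓘(ℝ, E) γ₀.proj).source) (ξ : CotangentSpace E γ.proj) :
    chartCoord (cotangentModel E) γ₀ γ (vertLift γ ξ) = (0, covecCoord γ₀.proj γ.proj ξ) := by
  have hd : ∀ x₀ : M, HasFDerivAt (fun t : ℝ ↦ covecCoord x₀ γ.proj (γ.snd + t • ξ))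
      ((ContinuousLinearMap.id ℝ ℝ).smulRight (covecCoord x₀ γ.proj ξ)) 0 := fun x₀ ↦ by
    simp only [map_add, map_smul]
    exact ((hasFDerivAt_id (0 : ℝ)).smul_const _).const_add _
  have hm : MDifferentiableAt 𝓘(ℝ, ℝ) (cotangentModel E)
      (fun t : ℝ ↦ (⟨γ.proj, γ.snd + t • ξ⟩ : CotangentBundle E M)) 0 := by
    rw [mdifferentiableAt_totalSpace]
    refine ⟨mdifferentiableAt_const, ?_⟩
    simp only [trivializationAt_cotangent]
    exact (hd _).differentiableAt.mdifferentiableAt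
  refine (chartCoord_mfderiv hm hγ (by simp) (1 : ℝ)).trans ?_
  have h : (fun t : ℝ ↦ extChartAt (cotangentModel E) γ₀
      (⟨γ.proj, γ.snd + t • ξ⟩ : CotangentBundle E M)) =
      fun t ↦ (extChartAt 𝓘(ℝ, E) γ₀.proj γ.proj, covecCoord γ₀.proj γ.proj (γ.snd + t • ξ)) :=
    funext fun t ↦ extChartAt_cotangent γ₀ hγ
  rw [h, mfderiv_eq_fderiv, ((hasFDerivAt_const _ _).prodMk (hd γ₀.proj)).fderiv]
  change ((0 : E), (1 : ℝ) • covecCoord γ₀.proj γ.proj ξ) = _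
  rw [one_smul]

theorem differentiableAt_chartForm {x₀ y : M} (hy : y ∈ (extChartAt 𝓘(ℝ, E) x₀).source)
    {α : Π x : M, CotangentSpace E x} (hα : OneFormMDiffAt α y) :
    DifferentiableAt ℝ (chartForm x₀ α) (extChartAt 𝓘(ℝ, E) x₀ y) := by
  set e := trivializationAt (E →L[ℝ] ℝ) (CotangentSpace E) x₀ with he
  have hb : y ∈ e.baseSet := by
    rw [he, hom_trivializationAt_baseSet]
    exact ⟨mem_baseSet_iff.2 hy, Set.mem_univ _⟩
  have h := (e.mdifferentiableAt_section_iff 𝓘(ℝ, E) α hb).1 hα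
  have h2 := (mfderiv_eq_fderiv_comp_chartCoord hy h).1
  refine h2.congr_of_eventuallyEq (Filter.Eventually.of_forall fun z ↦ ?_)
  exact (trivializationAt_cotangent (x₀ := x₀) (⟨(extChartAt 𝓘(ℝ, E) x₀).symm z,
    α ((extChartAt 𝓘(ℝ, E) x₀).symm z)⟩ : CotangentBundle E M)).symm

theorem chartCoord_mfderiv_oneForm {γ₀ : CotangentBundle E M} {y : M}
    (hy : y ∈ (extChartAt 𝓘(ℝ, E) γ₀.proj).source) {α : Π x : M, CotangentSpace E x}
    (hα : OneFormMDiffAt α y) (v : TangentSpace 𝓘(ℝ, E) y) :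
    chartCoord (cotangentModel E) γ₀ (⟨y, α y⟩ : CotangentBundle E M)
      (mfderiv 𝓘(ℝ, E) (cotangentModel E) (fun y ↦ (⟨y, α y⟩ : CotangentBundle E M)) y v) =
      (chartCoord 𝓘(ℝ, E) γ₀.proj y v, fderiv ℝ (chartForm γ₀.proj α)
        (extChartAt 𝓘(ℝ, E) γ₀.proj y) (chartCoord 𝓘(ℝ, E) γ₀.proj y v)) := by
  set x₀ := γ₀.proj with hx₀
  have hs := mem_extChartAt_source_cotangent γ₀ (γ := ⟨y, α y⟩) hy
  have h4 : MDifferentiableAt (cotangentModel E) 𝓘(ℝ, E × (E →L[ℝ] ℝ))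
      (extChartAt (cotangentModel E) γ₀) (⟨y, α y⟩ : CotangentBundle E M) :=
    (contMDiffAt_extChartAt' (n := 1)
      (by rwa [← extChartAt_source (cotangentModel E)])).mdifferentiableAt one_ne_zero
  have h5 : MDifferentiableAt 𝓘(ℝ, E) 𝓘(ℝ, E × (E →L[ℝ] ℝ)) (fun y ↦
      extChartAt (cotangentModel E) γ₀ (⟨y, α y⟩ : CotangentBundle E M)) y :=
    MDifferentiableAt.comp y (f := fun y ↦ (⟨y, α y⟩ : CotangentBundle E M)) h4 hα
  refine (chartCoord_mfderiv hα hy rfl v).trans ?_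
  refine ((mfderiv_eq_fderiv_comp_chartCoord hy h5).2 v).trans ?_
  have h6 : ((fun y ↦ extChartAt (cotangentModel E) γ₀ (⟨y, α y⟩ : CotangentBundle E M)) ∘
      (extChartAt 𝓘(ℝ, E) x₀).symm) =ᶠ[𝓝 (extChartAt 𝓘(ℝ, E) x₀ y)]
      fun z ↦ (z, chartForm x₀ α z) := by
    filter_upwards [(isOpen_extChartAt_target x₀).mem_nhds
      ((extChartAt 𝓘(ℝ, E) x₀).map_source hy)] with z hz
    rw [Function.comp_apply, extChartAt_cotangent γ₀ ((extChartAt 𝓘(ℝ, E) x₀).map_target hz)]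
    change (extChartAt 𝓘(ℝ, E) x₀ _, _) = _
    rw [(extChartAt 𝓘(ℝ, E) x₀).right_inv hz]
    rfl
  have h7 : HasFDerivAt (fun z ↦ (z, chartForm x₀ α z)) _ (extChartAt 𝓘(ℝ, E) x₀ y) :=
    (hasFDerivAt_id _).prodMk (differentiableAt_chartForm hy hα).hasFDerivAt
  rw [h6.fderiv_eq, h7.fderiv]
  rfl

variable {D : Connection E M} {x₀ : M} {Γ : E → E →L[ℝ] E →L[ℝ] E}

/-- Testing the Leibniz rule of the dual connection on fields with constant coordinates, for which
`D` reduces to `Γ`, yields minus the transpose of `Γ`. The hypothesis on `Γ` is the defining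
identity of `IsChristoffel` at the single point `y`. -/
theorem covecCoord_dual {y : M} (hy : y ∈ (extChartAt 𝓘(ℝ, E) x₀).source)
    (hΓ : ∀ (Y : Π x : M, TangentSpace 𝓘(ℝ, E) x), MDiffAt (T% Y) y →
      ∀ v : TangentSpace 𝓘(ℝ, E) y, chartCoord 𝓘(ℝ, E) x₀ y (D Y y v) =
      fderiv ℝ (chartField 𝓘(ℝ, E) x₀ Y) (extChartAt 𝓘(ℝ, E) x₀ y) (chartCoord 𝓘(ℝ, E) x₀ y v)
        + Γ (extChartAt 𝓘(ℝ, E) x₀ y) (chartCoord 𝓘(ℝ, E) x₀ y v)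
          (chartCoord 𝓘(ℝ, E) x₀ y (Y y)))
    {α : Π x : M, CotangentSpace E x} (hα : OneFormMDiffAt α y) (v : TangentSpace 𝓘(ℝ, E) y) :
    covecCoord x₀ y (dual D α y v) =
      fderiv ℝ (chartForm x₀ α) (extChartAt 𝓘(ℝ, E) x₀ y) (chartCoord 𝓘(ℝ, E) x₀ y v) -
        covecCoord x₀ y (α y) ∘L
          Γ (extChartAt 𝓘(ℝ, E) x₀ y) (chartCoord 𝓘(ℝ, E) x₀ y v) := by
  ext w
  have hYs := (smoothVectorFieldOn_chartVec (I := 𝓘(ℝ, E)) x₀ w).contMDiffAt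
    (isOpen_extChartAt_source x₀) hy
  have hY := hYs.mdifferentiableAt (by simp)
  have h1 := dualFun_apply D hα v hY
  have h2 := hΓ _ hY v
  have h3 : chartField 𝓘(ℝ, E) x₀ (fun y ↦ chartVec 𝓘(ℝ, E) x₀ y w)
      =ᶠ[𝓝 (extChartAt 𝓘(ℝ, E) x₀ y)] fun _ ↦ w := by
    filter_upwards [(isOpen_extChartAt_target x₀).mem_nhds
      ((extChartAt 𝓘(ℝ, E) x₀).map_source hy)] with z hz
    exact chartField_chartVec hz w
  rw [h3.fderiv_eq, chartCoord_chartVec hy] at h2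
  have h4 := (mfderiv_eq_fderiv_comp_chartCoord hy (mdifferentiableAt_pairing hα hY)).2 v
  have h5 : (fun y ↦ α y (chartVec 𝓘(ℝ, E) x₀ y w)) ∘ (extChartAt 𝓘(ℝ, E) x₀).symm =
      fun z ↦ chartForm x₀ α z w := rfl
  rw [h5, fderiv_clm_apply (differentiableAt_chartForm hy hα) (differentiableAt_const w)] at h4
  have h6 : D (fun y ↦ chartVec 𝓘(ℝ, E) x₀ y w) y v = chartVec 𝓘(ℝ, E) x₀ y
      (Γ (extChartAt 𝓘(ℝ, E) x₀ y) (chartCoord 𝓘(ℝ, E) x₀ y v) w) := by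
    apply chartCoord_injective hy
    rw [h2, chartCoord_chartVec hy]
    simp
  refine h1.trans ?_
  rw [h6]
  refine (congrArg (fun a : ℝ ↦ a - _) h4).trans ?_
  simp [covecCoord_apply]

/-- For a `1`-form `α` through `γ`, subtract from `dα(v)` the vertical lift of `D_v α`. The
derivative of the coefficients of `α` cancels and only `α ∘ Γ v` remains. -/
theorem chartCoord_horLift {γ₀ γ : CotangentBundle E M}
    (hγ : γ.proj ∈ (extChartAt 𝓘(ℝ, E) γ₀.proj).source)
    (hΓ : ∀ (Y : Π x : M, TangentSpace 𝓘(ℝ, E) x), MDiffAt (T% Y) γ.proj →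
      ∀ v : TangentSpace 𝓘(ℝ, E) γ.proj, chartCoord 𝓘(ℝ, E) γ₀.proj γ.proj (D Y γ.proj v) =
      fderiv ℝ (chartField 𝓘(ℝ, E) γ₀.proj Y) (extChartAt 𝓘(ℝ, E) γ₀.proj γ.proj)
        (chartCoord 𝓘(ℝ, E) γ₀.proj γ.proj v)
        + Γ (extChartAt 𝓘(ℝ, E) γ₀.proj γ.proj) (chartCoord 𝓘(ℝ, E) γ₀.proj γ.proj v)
          (chartCoord 𝓘(ℝ, E) γ₀.proj γ.proj (Y γ.proj)))
    (v : TangentSpace 𝓘(ℝ, E) γ.proj) :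
    chartCoord (cotangentModel E) γ₀ γ (horLift D γ v) =
      (chartCoord 𝓘(ℝ, E) γ₀.proj γ.proj v, covecCoord γ₀.proj γ.proj γ.snd ∘L
        Γ (extChartAt 𝓘(ℝ, E) γ₀.proj γ.proj) (chartCoord 𝓘(ℝ, E) γ₀.proj γ.proj v)) := by
  obtain ⟨y, ξ⟩ := γ
  obtain ⟨α, hα, rfl⟩ : ∃ α : Π x : M, CotangentSpace E x, OneFormMDiffAt α y ∧ α y = ξ :=
    ⟨extend (E →L[ℝ] ℝ) ξ, mdifferentiableAt_extend 𝓘(ℝ, E) (E →L[ℝ] ℝ) ξ, by simp⟩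
  have h1 := chartCoord_mfderiv_oneForm hγ hα v
  rw [mfderiv_oneForm D hα v] at h1
  have h2 := (chartCoord (cotangentModel E) γ₀ (⟨y, α y⟩ : CotangentBundle E M)).map_add
    (horLift D ⟨y, α y⟩ v) (vertLift ⟨y, α y⟩ (dual D α y v))
  rw [chartCoord_vertLift hγ, covecCoord_dual hγ hΓ hα] at h2
  refine (eq_sub_of_add_eq (h2.symm.trans h1)).trans ?_
  simp

end CotangentChart

/-! ### The matrix of the lift and its Nijenhuis tensor -/

section LiftForm

variable {F : Type*} [NormedAddCommGroup F] [NormedSpace ℝ F] [FiniteDimensional ℝ F]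

theorem hasFDerivAt_comp_fst {G H : Type*} [NormedAddCommGroup G] [NormedSpace ℝ G]
    [NormedAddCommGroup H] [NormedSpace ℝ H] {f : F → G} {ζ : F × H}
    (hf : DifferentiableAt ℝ f ζ.1) :
    HasFDerivAt (fun ζ : F × H ↦ f ζ.1) (fderiv ℝ f ζ.1 ∘L ContinuousLinearMap.fst ℝ F H) ζ :=
  hf.hasFDerivAt.comp ζ hasFDerivAt_fst

/-- In finite dimension an operator is a finite tuple of its values on a basis. This reduces the
differentiability of `liftForm` to that of its evaluations. -/
theorem differentiableAt_clm_of_apply {X G : Type*} [NormedAddCommGroup X] [NormedSpace ℝ X]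
    [NormedAddCommGroup G] [NormedSpace ℝ G] {f : X → F →L[ℝ] G} {x : X}
    (h : ∀ y, DifferentiableAt ℝ (fun x ↦ f x y) x) : DifferentiableAt ℝ f x := by
  let e := (ContinuousLinearEquiv.ofFinrankEq (Module.finrank_fin_fun ℝ).symm :
    F ≃L[ℝ] (Fin (Module.finrank ℝ F) → ℝ)).arrowCongr (ContinuousLinearEquiv.refl ℝ G) |>.trans
      (ContinuousLinearEquiv.piRing (Fin (Module.finrank ℝ F)))
  rw [← Function.id_comp f, ← e.symm_comp_self]
  exact e.symm.differentiableAt.comp x (differentiableAt_pi.2 fun i ↦ h _)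

/-- The coordinate expression of the lift to the cotangent bundle: with `(u, q)` written as the
horizontal vector `(u, p ∘ Γ u)` plus the vertical vector `(0, q - p ∘ Γ u)`, it is
`(u, p ∘ Γ u) ↦ (A u, p ∘ Γ (A u))` and `(0, q) ↦ (0, ε q ∘ A)`. -/
def liftForm (Γ : F → F →L[ℝ] F →L[ℝ] F) (A : F → F →L[ℝ] F) (ε : ℝ) (ζ : F × (F →L[ℝ] ℝ)) :
    (F × (F →L[ℝ] ℝ)) →L[ℝ] (F × (F →L[ℝ] ℝ)) :=
  (ContinuousLinearMap.inl ℝ F (F →L[ℝ] ℝ)) ∘L A ζ.1 ∘L ContinuousLinearMap.fst ℝ F (F →L[ℝ] ℝ) +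
  (ContinuousLinearMap.inr ℝ F (F →L[ℝ] ℝ)) ∘L
    ((ContinuousLinearMap.compL ℝ F F ℝ ζ.2 ∘L Γ ζ.1 ∘L A ζ.1) ∘L
        ContinuousLinearMap.fst ℝ F (F →L[ℝ] ℝ) +
      ε • ((ContinuousLinearMap.compL ℝ F F ℝ).flip (A ζ.1) ∘L
        (ContinuousLinearMap.snd ℝ F (F →L[ℝ] ℝ) -
          (ContinuousLinearMap.compL ℝ F F ℝ ζ.2 ∘L Γ ζ.1) ∘L
            ContinuousLinearMap.fst ℝ F (F →L[ℝ] ℝ))))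

variable {Γ : F → F →L[ℝ] F →L[ℝ] F} {A : F → F →L[ℝ] F} {ε : ℝ}

theorem liftForm_apply (ζ η : F × (F →L[ℝ] ℝ)) :
    liftForm Γ A ε ζ η =
      (A ζ.1 η.1, ζ.2 ∘L Γ ζ.1 (A ζ.1 η.1) + ε • ((η.2 - ζ.2 ∘L Γ ζ.1 η.1) ∘L A ζ.1)) := by
  simp [liftForm]

set_option synthInstance.maxHeartbeats 200000 in
theorem differentiableAt_liftForm {ζ : F × (F →L[ℝ] ℝ)} (hΓ : DifferentiableAt ℝ Γ ζ.1)
    (hA : DifferentiableAt ℝ A ζ.1) : DifferentiableAt ℝ (liftForm Γ A ε) ζ := by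
  have hA' := (hasFDerivAt_comp_fst (H := F →L[ℝ] ℝ) hA).differentiableAt
  have hΓ' := (hasFDerivAt_comp_fst (G := F →L[ℝ] F →L[ℝ] F) (H := F →L[ℝ] ℝ) hΓ).differentiableAt
  have hp : DifferentiableAt ℝ (fun ζ : F × (F →L[ℝ] ℝ) ↦ ζ.2) ζ := differentiableAt_snd
  refine differentiableAt_clm_of_apply fun η ↦ ?_
  simp only [liftForm_apply]
  have hAη := hA'.clm_apply (differentiableAt_const η.1)
  refine hAη.prodMk (differentiableAt_clm_of_apply fun w ↦ ?_)
  have hAw := hA'.clm_apply (differentiableAt_const w)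
  simp only [add_apply, sub_apply, smul_apply, smul_eq_mul, ContinuousLinearMap.comp_apply]
  exact (hp.clm_apply ((hΓ'.clm_apply hAη).clm_apply (differentiableAt_const w))).add
    ((((differentiableAt_const η.2).clm_apply hAw).sub
      (hp.clm_apply ((hΓ'.clm_apply (differentiableAt_const η.1)).clm_apply hAw))).const_mul ε)

set_option synthInstance.maxHeartbeats 200000 in
theorem fderiv_liftForm_apply {ζ : F × (F →L[ℝ] ℝ)} (hΓ : DifferentiableAt ℝ Γ ζ.1)
    (hA : DifferentiableAt ℝ A ζ.1) (θ η : F × (F →L[ℝ] ℝ)) :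
    fderiv ℝ (liftForm Γ A ε) ζ θ η =
      (fderiv ℝ A ζ.1 θ.1 η.1,
        θ.2 ∘L Γ ζ.1 (A ζ.1 η.1) + ζ.2 ∘L fderiv ℝ Γ ζ.1 θ.1 (A ζ.1 η.1)
          + ζ.2 ∘L Γ ζ.1 (fderiv ℝ A ζ.1 θ.1 η.1)
          + ε • ((η.2 - ζ.2 ∘L Γ ζ.1 η.1) ∘L fderiv ℝ A ζ.1 θ.1
            - (θ.2 ∘L Γ ζ.1 η.1 + ζ.2 ∘L fderiv ℝ Γ ζ.1 θ.1 η.1) ∘L A ζ.1)) := by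
  have hA' := hasFDerivAt_comp_fst (H := F →L[ℝ] ℝ) hA
  have hΓ' := hasFDerivAt_comp_fst (G := F →L[ℝ] F →L[ℝ] F) (H := F →L[ℝ] ℝ) hΓ
  have hp : HasFDerivAt (fun ζ : F × (F →L[ℝ] ℝ) ↦ ζ.2)
    (ContinuousLinearMap.snd ℝ F (F →L[ℝ] ℝ)) ζ := hasFDerivAt_snd
  -- The formula follows from uniqueness of derivatives: for fixed `η`, and fixed `w` in the fibre
  -- component, the evaluated field is also differentiated by the product rule.
  have hL := (differentiableAt_liftForm (ε := ε) hΓ hA).hasFDerivAt.clm_apply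
    (hasFDerivAt_const η ζ)
  refine Prod.ext ?_ (ContinuousLinearMap.ext fun w ↦ ?_)
  · have h1 := hA'.clm_apply (hasFDerivAt_const η.1 ζ)
    have h2 := hL.fst
    simp only [liftForm_apply] at h2
    have h3 := DFunLike.congr_fun (h2.unique h1) θ
    simpa using h3
  · have hAη := hA'.clm_apply (hasFDerivAt_const η.1 ζ)
    have hAw := hA'.clm_apply (hasFDerivAt_const w ζ)
    have h1 := hp.clm_apply ((hΓ'.clm_apply hAη).clm_apply (hasFDerivAt_const w ζ))
    have h2 := hp.clm_apply ((hΓ'.clm_apply (hasFDerivAt_const η.1 ζ)).clm_apply hAw)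
    have h3 := h1.add ((((hasFDerivAt_const η.2 ζ).clm_apply hAw).sub h2).const_mul ε)
    have h4 := hL.snd.clm_apply (hasFDerivAt_const w ζ)
    have h5 : (fun ζ ↦ (liftForm Γ A ε ζ η).2 w) = fun ζ ↦ ζ.2 (Γ ζ.1 (A ζ.1 η.1) w) +
        ε * (η.2 (A ζ.1 w) - ζ.2 (Γ ζ.1 η.1 (A ζ.1 w))) := funext fun ζ ↦ by
      simp [liftForm_apply]
    rw [h5] at h4
    have h6 := DFunLike.congr_fun (h4.unique h3) θ
    simp only [ContinuousLinearMap.comp_zero, zero_add, ContinuousLinearMap.flip_apply,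
      ContinuousLinearMap.comp_apply, add_apply, sub_apply, smul_apply, smul_eq_mul,
      ContinuousLinearMap.coe_fst', ContinuousLinearMap.coe_snd'] at h6 ⊢
    rw [h6]
    simp only [map_add, zero_apply]
    ring

/-- Differentiate `A² = -1`, which therefore has to hold on a neighbourhood. -/
theorem fderiv_anticomm {z : F} (hA : DifferentiableAt ℝ A z)
    (hsq : ∀ᶠ y in 𝓝 z, ∀ v, A y (A y v) = -v) (h v : F) :
    fderiv ℝ A z h (A z v) = -A z (fderiv ℝ A z h v) := by
  have h1 := hA.hasFDerivAt.clm_apply (hA.hasFDerivAt.clm_apply (hasFDerivAt_const v z))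
  have h2 : (fun y ↦ A y (A y v)) =ᶠ[𝓝 z] fun _ ↦ -v := hsq.mono fun y hy ↦ hy v
  have h3 := DFunLike.congr_fun ((h1.congr_of_eventuallyEq h2.symm).unique
    (hasFDerivAt_const (-v) z)) h
  simp at h3
  rw [add_comm] at h3
  exact eq_neg_of_add_eq_zero_left h3

/-- The Nijenhuis tensor of the lift, on `(u, p ∘ Γ u + q)` and `(v, p ∘ Γ v + s)`. -/
theorem nijenhuisForm_liftForm (hε : ε = 1 ∨ ε = -1) {z : F} (p : F →L[ℝ] ℝ)
    (hΓ : DifferentiableAt ℝ Γ z) (hA : DifferentiableAt ℝ A z)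
    (hsq : ∀ᶠ y in 𝓝 z, ∀ v, A y (A y v) = -v) (u v : F) (q s : F →L[ℝ] ℝ) (w : F) :
    (nijenhuisForm (liftForm Γ A ε) (z, p) (u, p ∘L Γ z u + q) (v, p ∘L Γ z v + s)).1 =
      nijenhuisForm A z u v ∧
    (nijenhuisForm (liftForm Γ A ε) (z, p) (u, p ∘L Γ z u + q) (v, p ∘L Γ z v + s)).2 w =
      p (Γ z (nijenhuisForm A z u v) w)
      + p ((curvForm Γ z u v w - curvForm Γ z (A z u) (A z v) w)
          + ε • (curvForm Γ z (A z u) v (A z w) + curvForm Γ z u (A z v) (A z w)))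
      + s (ε • covEndForm Γ A z (A z u) w - covEndForm Γ A z u (A z w))
      - q (ε • covEndForm Γ A z (A z v) w - covEndForm Γ A z v (A z w)) := by
  have hsq' : ∀ v, A z (A z v) = -v := hsq.self_of_nhds
  have hac := fderiv_anticomm hA hsq
  constructor
  · simp only [nijenhuisForm, liftForm_apply, fderiv_liftForm_apply (ζ := (z, p)) hΓ hA,
      Prod.fst_sub, Prod.fst_add]
  · simp only [nijenhuisForm, liftForm_apply, fderiv_liftForm_apply (ζ := (z, p)) hΓ hA,
      Prod.snd_sub, Prod.snd_add, curvForm, covEndForm]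
    -- Splitting on the sign supplies `ε² = 1`. The remaining identity is linear algebra modulo `A²
    -- = -1` and the anticommutation of `A` with its derivative.
    rcases hε with rfl | rfl <;>
    · simp [hsq', hac]
      ring

theorem covEndForm_anticomm {z : F} (hA : DifferentiableAt ℝ A z)
    (hsq : ∀ᶠ y in 𝓝 z, ∀ v, A y (A y v) = -v) (u w : F) :
    covEndForm Γ A z u (A z w) = -A z (covEndForm Γ A z u w) := by
  simp only [covEndForm, fderiv_anticomm hA hsq, map_sub, map_add, hsq.self_of_nhds, map_neg]
  abel

theorem nijenhuisForm_liftForm_eq_zero_iff (hε : ε = 1 ∨ ε = -1) {z : F}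
    (hΓ : DifferentiableAt ℝ Γ z) (hA : DifferentiableAt ℝ A z)
    (hsq : ∀ᶠ y in 𝓝 z, ∀ v, A y (A y v) = -v) :
    (∀ (p : F →L[ℝ] ℝ) (a b : F × (F →L[ℝ] ℝ)),
      nijenhuisForm (liftForm Γ A ε) (z, p) a b = 0) ↔
    (∀ u v, nijenhuisForm A z u v = 0) ∧
    (∀ u w, covEndForm Γ A z u w = ε • A z (covEndForm Γ A z (A z u) w)) ∧
    (∀ u v w, (curvForm Γ z u v w - curvForm Γ z (A z u) (A z v) w)
          + ε • (curvForm Γ z (A z u) v (A z w) + curvForm Γ z u (A z v) (A z w)) = 0) := by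
  have hsq' : ∀ v, A z (A z v) = -v := hsq.self_of_nhds
  have hkey := nijenhuisForm_liftForm hε (hΓ := hΓ) (hA := hA) (hsq := hsq)
  -- The second condition is the vanishing of the coefficient of `s`: substitute `A w` for `w` in
  -- one direction, apply `A` in the other, and anticommute.
  have hcov : (∀ u w, covEndForm Γ A z u w = ε • A z (covEndForm Γ A z (A z u) w)) ↔
      ∀ u w, ε • covEndForm Γ A z (A z u) w - covEndForm Γ A z u (A z w) = 0 := by
    refine forall_congr' fun u ↦ ?_
    constructor
    · intro h w
      rw [h (A z w), covEndForm_anticomm hA hsq, map_neg, hsq', neg_neg, sub_self]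
    · intro h w
      have h1 := congrArg (A z) (h w)
      rw [covEndForm_anticomm hA hsq, sub_neg_eq_add, map_add, map_smul, hsq', map_zero] at h1
      rw [← sub_eq_zero, ← neg_sub, sub_eq_add_neg, h1, neg_zero]
  rw [hcov]
  constructor
  · intro h
    have hN : ∀ u v, nijenhuisForm A z u v = 0 := fun u v ↦ by
      have := (hkey 0 u v 0 0 0).1
      rw [h] at this
      exact this.symm
    refine ⟨hN, fun u w ↦ ?_, fun u v w ↦ ?_⟩
    -- At the zero covector, a horizontal and a vertical vector isolate the coefficient of `s`.
    · refine SeparatingDual.eq_zero_of_forall_dual_eq_zero (R := ℝ) fun s ↦ ?_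
      have := (hkey 0 u 0 0 s w).2
      rw [h] at this
      simpa using this.symm
    -- Two horizontal vectors isolate the terms in `p`. The one containing `Γ` drops out because `N
    -- = 0` is already known.
    · refine SeparatingDual.eq_zero_of_forall_dual_eq_zero (R := ℝ) fun p ↦ ?_
      have := (hkey p u v 0 0 w).2
      rw [h, hN] at this
      simpa using this.symm
  · rintro ⟨h1, h2, h3⟩ p ⟨u, q⟩ ⟨v, s⟩
    -- Subtracting the fibre part of the horizontal lift presents arbitrary vectors as horizontal
    -- plus vertical.
    have h4 := hkey p u v (q - p ∘L Γ z u) (s - p ∘L Γ z v)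
    rw [add_sub_cancel, add_sub_cancel] at h4
    refine Prod.ext ((h4 0).1.trans (h1 u v)) (ContinuousLinearMap.ext fun w ↦ ?_)
    rw [(h4 w).2, h1, h2, h2, h3]
    simp

end LiftForm

/-! ### The lift is represented by `liftForm` -/

section Main

variable {E : Type*} [NormedAddCommGroup E] [NormedSpace ℝ E] [FiniteDimensional ℝ E]
  {M : Type*} [TopologicalSpace M] [ChartedSpace E M] [IsManifold 𝓘(ℝ, E) ∞ M]
  {D : Connection E M} {J : Π x : M, TangentSpace 𝓘(ℝ, E) x →L[ℝ] TangentSpace 𝓘(ℝ, E) x}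

theorem covecCoord_self (x : M) (p : CotangentSpace E x) : covecCoord x x p = p := by
  ext w
  rw [covecCoord_apply]
  exact congrArg p (chartVec_self x w)

theorem chartCoord_splitting {γ₀ γ : CotangentBundle E M} {Γ : E → E →L[ℝ] E →L[ℝ] E}
    (hγ : γ.proj ∈ (extChartAt 𝓘(ℝ, E) γ₀.proj).source)
    (hΓ : ∀ (Y : Π x : M, TangentSpace 𝓘(ℝ, E) x), MDiffAt (T% Y) γ.proj →
      ∀ v : TangentSpace 𝓘(ℝ, E) γ.proj, chartCoord 𝓘(ℝ, E) γ₀.proj γ.proj (D Y γ.proj v) =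
      fderiv ℝ (chartField 𝓘(ℝ, E) γ₀.proj Y) (extChartAt 𝓘(ℝ, E) γ₀.proj γ.proj)
        (chartCoord 𝓘(ℝ, E) γ₀.proj γ.proj v)
        + Γ (extChartAt 𝓘(ℝ, E) γ₀.proj γ.proj) (chartCoord 𝓘(ℝ, E) γ₀.proj γ.proj v)
          (chartCoord 𝓘(ℝ, E) γ₀.proj γ.proj (Y γ.proj)))
    (v : TangentSpace 𝓘(ℝ, E) γ.proj) (ξ : CotangentSpace E γ.proj) :
    chartCoord (cotangentModel E) γ₀ γ (splitting D γ (v, ξ)) =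
      (chartCoord 𝓘(ℝ, E) γ₀.proj γ.proj v, covecCoord γ₀.proj γ.proj γ.snd ∘L
        Γ (extChartAt 𝓘(ℝ, E) γ₀.proj γ.proj) (chartCoord 𝓘(ℝ, E) γ₀.proj γ.proj v)
          + covecCoord γ₀.proj γ.proj ξ) := by
  have h := (chartCoord (cotangentModel E) γ₀ γ).map_add (horLift D γ v) (vertLift γ ξ)
  rw [chartCoord_horLift hγ hΓ, chartCoord_vertLift hγ] at h
  refine Eq.trans h ?_
  rw [Prod.mk_add_mk, add_zero]

/-- The field of endomorphisms `J^±` of `T^*M` in the preferred chart at `γ₀`. -/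
theorem isChartRep_cotangentLift (γ₀ : CotangentBundle E M) {Γ : E → E →L[ℝ] E →L[ℝ] E}
    {A : E → E →L[ℝ] E} (hΓ : IsChristoffel D γ₀.proj Γ)
    (hA : IsChartRep 𝓘(ℝ, E) J γ₀.proj A) (ε : ℝ) :
    IsChartRep (cotangentModel E) (cotangentLift D (diagGen J ε)) γ₀ (liftForm Γ A ε) where
  differentiableAt := by
    have h := extChartAt_cotangent γ₀ (mem_extChartAt_source (I := 𝓘(ℝ, E)) γ₀.proj)
    exact differentiableAt_liftForm (by rw [h]; exact hΓ.contDiffAt.differentiableAt (by simp))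
      (by rw [h]; exact hA.differentiableAt)
  apply := by
    have hc : Filter.Tendsto (fun γ : CotangentBundle E M ↦ γ.proj) (𝓝 γ₀) (𝓝 γ₀.proj) :=
      (FiberBundle.continuous_proj (E →L[ℝ] ℝ) (CotangentSpace E : M → Type _)).tendsto γ₀
    filter_upwards [hc.eventually hΓ.apply, hc.eventually hA.apply,
      hc.eventually ((isOpen_extChartAt_source (I := 𝓘(ℝ, E)) γ₀.proj).mem_nhds
        (mem_extChartAt_source γ₀.proj))] with γ h1 h2 hγ w
    -- Every tangent vector comes from the splitting, in which the lifted structure is diagonal.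
    obtain ⟨⟨v, ξ⟩, rfl⟩ := (splitting D γ).surjective w
    have h3 : cotangentLift D (diagGen J ε) γ (splitting D γ (v, ξ)) =
        splitting D γ (J γ.proj v, ε • (ξ ∘L J γ.proj)) := by
      rw [cotangentLift, ContinuousLinearMap.comp_apply, ContinuousLinearMap.comp_apply]
      simp only [ContinuousLinearEquiv.coe_coe, ContinuousLinearEquiv.symm_apply_apply]
      rfl
    rw [h3, chartCoord_splitting hγ h1, chartCoord_splitting hγ h1, extChartAt_cotangent γ₀ hγ,
      liftForm_apply]
    refine Prod.ext (h2 v) ?_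
    simp only [h2 v, add_sub_cancel_left]
    congr 1
    rw [map_smul]
    congr 1
    ext w
    simp only [covecCoord_apply, ContinuousLinearMap.comp_apply]
    congr 1
    -- What remains is that `J` applied to the vector with coordinates `w` has coordinates `A w`.
    -- This converts `ξ ∘ J` into its coordinate form.
    apply chartCoord_injective hγ
    rw [h2, chartCoord_chartVec hγ, chartCoord_chartVec hγ]

end Main

end CotangentLift

end

/-! ### Assembling the equivalence -/

open CotangentLift

theorem proposition5p1 {E : Type*} [NormedAddCommGroup E] [NormedSpace ℝ E]
    [FiniteDimensional ℝ E] {M : Type*} [TopologicalSpace M] [ChartedSpace E M]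
    [IsManifold 𝓘(ℝ, E) ∞ M] [T2Space M]
    (J : Π x : M, TangentSpace 𝓘(ℝ, E) x →L[ℝ] TangentSpace 𝓘(ℝ, E) x)
    (hJ : IsAlmostComplex 𝓘(ℝ, E) J)
    (D : Connection E M) [CovariantDerivative.ContMDiffCovariantDerivative D ∞]
    (ε : ℝ) (hε : ε = 1 ∨ ε = -1) :
    IsIntegrable (cotangentModel E) (cotangentLift D (diagGen J ε)) ↔
      IsIntegrable 𝓘(ℝ, E) J ∧
      (∀ U : Set M, IsOpen U → ∀ X Y : Π x : M, TangentSpace 𝓘(ℝ, E) x,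
        SmoothVectorFieldOn 𝓘(ℝ, E) X U → SmoothVectorFieldOn 𝓘(ℝ, E) Y U → ∀ x ∈ U,
          covDerivEnd D J X Y x = ε • J x (covDerivEnd D J (fun y ↦ J y (X y)) Y x)) ∧
      (∀ U : Set M, IsOpen U → ∀ X Y Z : Π x : M, TangentSpace 𝓘(ℝ, E) x,
        SmoothVectorFieldOn 𝓘(ℝ, E) X U → SmoothVectorFieldOn 𝓘(ℝ, E) Y U →
        SmoothVectorFieldOn 𝓘(ℝ, E) Z U → ∀ x ∈ U,
          (curvature D X Y Z x
              - curvature D (fun y ↦ J y (X y)) (fun y ↦ J y (Y y)) Z x)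
            + ε • (curvature D (fun y ↦ J y (X y)) Y (fun y ↦ J y (Z y)) x
              + curvature D X (fun y ↦ J y (Y y)) (fun y ↦ J y (Z y)) x) = 0) := by
  choose Γ hΓ using exists_isChristoffel D
  have hA := isChartRep_chartEnd hJ
  set A := fun x ↦ chartEnd 𝓘(ℝ, E) x J with hAdef
  set z := fun x : M ↦ extChartAt 𝓘(ℝ, E) x x with hz
  have hAC : ∀ x, ContDiffAt ℝ ∞ (A x) (z x) := fun x ↦ contDiffAt_chartEnd (hJ.smooth x)
  have hs : ∀ x : M, x ∈ (extChartAt 𝓘(ℝ, E) x).source := fun x ↦ mem_extChartAt_source x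
  have hsq : ∀ x, ∀ᶠ y in 𝓝 (z x), ∀ v, A x y (A x y v) = -v := fun x ↦ by
    filter_upwards [eventually_mem_target (I := 𝓘(ℝ, E)) x] with y hy v
    have hy' := (extChartAt 𝓘(ℝ, E) x).map_target hy
    have h := fun w ↦ chartEnd_apply hy' J w
    rw [(extChartAt 𝓘(ℝ, E) x).right_inv hy] at h
    rw [← chartCoord_chartVec hy' v]
    simp only [hAdef, h, hJ.sq, map_neg]
  have hiff := fun x ↦ nijenhuisForm_liftForm_eq_zero_iff hε
    ((hΓ x).contDiffAt.differentiableAt (by simp)) (hA x).differentiableAt (hsq x)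
  have hlift : IsIntegrable (cotangentModel E) (cotangentLift D (diagGen J ε)) ↔
      ∀ (x : M) (p : E →L[ℝ] ℝ) (a b : E × (E →L[ℝ] ℝ)),
        nijenhuisForm (liftForm (Γ x) (A x) ε) (z x, p) a b = 0 := by
    rw [isIntegrable_iff (fun γ₀ ↦ isChartRep_cotangentLift γ₀ (hΓ γ₀.proj) (hA γ₀.proj) ε)
      (fun γ w ↦ cotangentLift_sq D hJ.sq hε γ w)]
    -- The matrix used at `γ₀` depends only on its base point, and the chart sends `γ₀` to `(z, p)`
    -- with `p` the covector itself. Quantifying over `γ₀` is thus quantifying over `x` and all `p`.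
    have hchart : ∀ γ₀ : CotangentBundle E M, extChartAt (cotangentModel E) γ₀ γ₀ =
        (z γ₀.proj, γ₀.snd) := fun γ₀ ↦ by
      rw [extChartAt_cotangent γ₀ (hs _), covecCoord_self]
      rfl
    constructor
    · intro h x p a b
      have := h (⟨x, p⟩ : CotangentBundle E M) a b
      rwa [hchart] at this
    · intro h γ₀ a b
      rw [hchart]
      exact h γ₀.proj γ₀.snd a b
  rw [hlift, isIntegrable_iff hA hJ.sq]
  refine (forall_congr' hiff).trans ?_
  rw [forall_and, forall_and]
  have hJX : ∀ {x : M} {X : Π x : M, TangentSpace 𝓘(ℝ, E) x}, MDiffAt (T% X) x →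
      MDiffAt (T% (fun y ↦ J y (X y))) x := fun {x X} hX ↦ (hA x).mdifferentiableAt hX
  have hsm : ∀ {x : M} {U : Set M} {X : Π x : M, TangentSpace 𝓘(ℝ, E) x}, IsOpen U →
      SmoothVectorFieldOn 𝓘(ℝ, E) X U → x ∈ U → MDiffAt (T% X) x := fun hU hX hx ↦
    (hX.contMDiffAt hU hx).mdifferentiableAt (by simp)
  have hchart := fun (x : M) (v : E) ↦ smoothVectorFieldOn_chartVec (I := 𝓘(ℝ, E)) x v
  have hopen := fun x : M ↦ isOpen_extChartAt_source (I := 𝓘(ℝ, E)) x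
  refine and_congr Iff.rfl (and_congr ?_ ?_)
  · have key : ∀ {x : M} {U : Set M} {X Y : Π x : M, TangentSpace 𝓘(ℝ, E) x}, IsOpen U →
        SmoothVectorFieldOn 𝓘(ℝ, E) Y U → x ∈ U →
        (covDerivEnd D J X Y x = ε • J x (covDerivEnd D J (fun y ↦ J y (X y)) Y x) ↔
        covEndForm (Γ x) (A x) (z x) (X x) (Y x) =
          ε • A x (z x) (covEndForm (Γ x) (A x) (z x) (A x (z x) (X x)) (Y x))) := by
      intro x U X Y hU hY hx
      rw [(hA x).apply_self, covDerivEnd_eq_covEndForm (hΓ x) (hA x) _ (hsm hU hY hx),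
        covDerivEnd_eq_covEndForm (hΓ x) (hA x) _ (hsm hU hY hx), (hA x).apply_self]
      rfl
    constructor
    · intro h U hU X Y _ hY x hx
      exact (key hU hY hx).2 (h x _ _)
    · intro h x u w
      -- Fields with constant coordinates take the prescribed values `u` and `w` at `x`.
      have := (key (hopen x) (hchart x w) (hs x)).1 (h _ (hopen x) _ _ (hchart x u) (hchart x w)
        x (hs x))
      simpa only [chartVec_self] using this
  · have key : ∀ {x : M} {U : Set M} {X Y Z : Π x : M, TangentSpace 𝓘(ℝ, E) x}, IsOpen U →
        SmoothVectorFieldOn 𝓘(ℝ, E) X U → SmoothVectorFieldOn 𝓘(ℝ, E) Y U →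
        SmoothVectorFieldOn 𝓘(ℝ, E) Z U → x ∈ U →
        ((curvature D X Y Z x
              - curvature D (fun y ↦ J y (X y)) (fun y ↦ J y (Y y)) Z x)
            + ε • (curvature D (fun y ↦ J y (X y)) Y (fun y ↦ J y (Z y)) x
              + curvature D X (fun y ↦ J y (Y y)) (fun y ↦ J y (Z y)) x) =
        ((curvForm (Γ x) (z x) (X x) (Y x) (Z x)
            - curvForm (Γ x) (z x) (A x (z x) (X x)) (A x (z x) (Y x)) (Z x))
          + ε • (curvForm (Γ x) (z x) (A x (z x) (X x)) (Y x) (A x (z x) (Z x))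
            + curvForm (Γ x) (z x) (X x) (A x (z x) (Y x)) (A x (z x) (Z x))) : E)) := by
      intro x U X Y Z hU hX hY hZ hx
      have hX' := hsm hU hX hx
      have hY' := hsm hU hY hx
      have hZ' : ∀ᶠ y in 𝓝 x, MDiffAt (T% Z) y := by
        filter_upwards [hU.mem_nhds hx] with y hy using hsm hU hZ hy
      have hZc := contDiffAt_chartField (hs x) (hZ.contMDiffAt hU hx)
      have hJZc : ContDiffAt ℝ ∞ (chartField 𝓘(ℝ, E) x (fun y ↦ J y (Z y))) (z x) :=
        ((hAC x).clm_apply hZc).congr_of_eventuallyEq ((hA x).chartField Z)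
      -- At each nearby `y` this uses the representation of `J` in the chart at `y`, not in the one
      -- at `x`.
      have hJZ' : ∀ᶠ y in 𝓝 x, MDiffAt (T% (fun y ↦ J y (Z y))) y := hZ'.mono fun y hy ↦ hJX hy
      rw [curvature_eq_curvForm (hΓ x) hX' hY' hZ' hZc,
        curvature_eq_curvForm (hΓ x) (hJX hX') (hJX hY') hZ' hZc,
        curvature_eq_curvForm (hΓ x) (hJX hX') hY' hJZ' hJZc,
        curvature_eq_curvForm (hΓ x) hX' (hJX hY') hJZ' hJZc, (hA x).apply_self,
        (hA x).apply_self, (hA x).apply_self]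
      rfl
    constructor
    · intro h U hU X Y Z hX hY hZ x hx
      exact (key hU hX hY hZ hx).trans (h x _ _ _)
    · intro h x u v w
      have := (key (hopen x) (hchart x u) (hchart x v) (hchart x w) (hs x)).symm.trans
        (h _ (hopen x) _ _ _ (hchart x u) (hchart x v) (hchart x w) x (hs x))
      simp only [chartVec_self] at this
      exact this
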